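/- Let $1\le k\le \ell$ be integers and $q,z\in\mathbb C$ with $q\neq 0$, $q^{2n}\ne 1$ for $1\le n\le \ell$, and $zq^{-2(j-a)}\neq q^2$ for $1\le a\le k$, $1\le j\le \ell$ (so that everything below is defined). *Algebra.* Let $H_n(q)$ be the Hecke algebra with (stochastic) generators $\sigma_1,\dots,\sigma_{n-1}$ and relations $\sigma_i^2=(1-q^2)\sigma_i+q^2$, $\sigma_i\sigma_{i+1}\sigma_i=\sigma_{i+1}\sigma_i\sigma_{i+1}$, and $\sigma_i\sigma_j=\sigma_j\sigma_i$ for $|i-j|>1$. Put $$R_i(u)=\frac{1-u}{q^2-u}\,\sigma_i+\frac{q^2-1}{q^2-u},\qquad S_{[i,j]}=\prod_{i\le a\le j-1}^{\longrightarrow}R_a(q^{-2(a-i+1)})R_{a-1}(q^{-2(a-i)})\cdots R_i(q^{-2}),$$ $P^{(a,b)}=S_{[1,a]}S_{[a+1,a+b]}$, and, in $H_{k+\ell}(q)$, $$R^{(k,\ell)}(z)=P^{(k,\ell)}\prod_{1\le a\le k}^{\longleftarrow}R_a(zq^{-2(1-a)})R_{a+1}(zq^{-2(2-a)})\cdots R_{a+\ell-1}(zq^{-2(\ell-a)})\;P^{(\ell,k)},$$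 where the arrow $\rightarrow$ (resp. $\leftarrow$) means that $a$ increases from left to right (resp. from right to left). *Representation.* $H_n(q)$ acts on $(\mathbb C^2)^{\otimes n}$, $\sigma_i$ acting on the factors $i,i+1$ by $e_x\otimes e_x\mapsto e_x\otimes e_x$, $e_1\otimes e_2\mapsto e_2\otimes e_1+(1-q^2)e_1\otimes e_2$, $e_2\otimes e_1\mapsto q^2e_1\otimes e_2$. Elements of $H_n(q)$ are identified with their matrices in the standard basis (the column indexed by a basis vector holds its image). *Bases.* For $(a,b)\in\{(k,\ell),(\ell,k)\}$, $0\le i\le a$, $0\le j\le b$, let $w^{(a,b)}_{i,j}=e_1^{\otimes i}\otimes e_2^{\otimes (a-i)}\otimes e_1^{\otimes j}\otimes e_2^{\otimes (b-j)}$. *Formula.* With $[n]=\frac{1-q^{2n}}{1-q^2}$, $\binom nm=\frac{[n]!}{[m]!\,[n-m]!}$ (zero unless $0\le m\le n$) and $(a;x)_n=\prod_{i=0}^{n-1}(1-ax^i)$, let $$a_p^{(k,\ell)}(z)=\binom kp q^{-2\ell p}\frac{(q^{-2\ell};q^2)_{k-p}(z;q^2)_p}{(zq^{-2\ell};q^2)_k},$$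 $$J_m(k'',\ell'';\ell''+\delta,k''-\delta)=\binom{k''}{k''-\delta}(q^{2(m-\ell'')};q^{-2})_\delta\,q^{2(m-\ell''-\delta)(k''-\delta)}\quad(\text{zero if }\delta<0),$$ and let $F(k',\ell';\tilde\ell,\tilde k)$ be $0$ if $k'+\ell'\ne\tilde\ell+\tilde k$, and otherwise $$\sum_{p=0}^{k}\sum_{k''=0}^{p}\sum_{\ell''=0}^{\ell-k+p}a_p^{(k,\ell)}(z)\,\frac{\binom{k-p}{k'-k''}\binom{p}{k''}q^{2k''(k-p-k'+k'')}}{\binom{k}{k'}}\cdot\frac{\binom{k-p}{\ell'-\ell''}\binom{\ell-k+p}{\ell''}q^{2(\ell'-\ell'')(\ell-k+p-\ell'')}}{\binom{\ell}{\ell'}}\;J_{\ell-k+p}(k'',\ell'';\tilde\ell-k'+k'',\tilde k-\ell'+\ell'').$$ Then the $(k',\ell';\tilde\ell,\tilde k)$ entry of $R^{(k,\ell)}(z)$ is $F(k',\ell';\tilde\ell,\tilde k)$, in the following two forms. 1. (Action on column vectors.) For both choices of $(a,b)$, the vectors $v^{(a,b)}_{i,j}=\binom ai\binom bj P^{(a,b)}w^{(a,b)}_{i,j}$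 form a basis of $L_{(a)}\otimes L_{(b)}:=P^{(a,b)}\big((\mathbb C^2)^{\otimes(k+\ell)}\big)$, and for all $0\le\tilde\ell\le\ell$, $0\le\tilde k\le k$ $$R^{(k,\ell)}(z)\,v^{(\ell,k)}_{\tilde\ell,\tilde k}=\sum_{k'=0}^k\sum_{\ell'=0}^{\ell}F(k',\ell';\tilde\ell,\tilde k)\,v^{(k,\ell)}_{k',\ell'} .$$ 2. (Action on row vectors.) For both choices of $(a,b)$, the row vectors $\pi^{(a,b)}_{i,j}=(w^{(a,b)}_{i,j})^{T}P^{(a,b)}$ form a basis of the row space of $P^{(a,b)}$, and for all $0\le k'\le k$, $0\le\ell'\le\ell$ $$\pi^{(k,\ell)}_{k',\ell'}\,R^{(k,\ell)}(z)=\sum_{\tilde\ell=0}^{\ell}\sum_{\tilde k=0}^{k}F(k',\ell';\tilde\ell,\tilde k)\,\pi^{(\ell,k)}_{\tilde\ell,\tilde k}.$$ -/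

import Mathlib

/-! ### The Hecke algebra in its stochastic presentation -/

/-- Indices `1, …, n - 1` of the generators of the Hecke algebra on `n` strands. -/
abbrev HeckeIndex (n : ℕ) : Type := {i : ℕ // 1 ≤ i ∧ i < n}

/-- Defining relations of the Hecke algebra in terms of the stochastic generators
`-q σ_i`: quadratic relation, braid relation, far commutation. -/
inductive HeckeRel (q : ℂ) (n : ℕ) :
    FreeAlgebra ℂ (HeckeIndex n) → FreeAlgebra ℂ (HeckeIndex n) → Prop
  | quad (i : HeckeIndex n) :
      HeckeRel q n (FreeAlgebra.ι ℂ i * FreeAlgebra.ι ℂ i)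
        ((1 - q ^ 2) • FreeAlgebra.ι ℂ i + (q ^ 2) • (1 : FreeAlgebra ℂ (HeckeIndex n)))
  | braid (i j : HeckeIndex n) (h : j.1 = i.1 + 1) :
      HeckeRel q n (FreeAlgebra.ι ℂ i * FreeAlgebra.ι ℂ j * FreeAlgebra.ι ℂ i)
        (FreeAlgebra.ι ℂ j * FreeAlgebra.ι ℂ i * FreeAlgebra.ι ℂ j)
  | comm (i j : HeckeIndex n) (h : i.1 + 1 < j.1) :
      HeckeRel q n (FreeAlgebra.ι ℂ i * FreeAlgebra.ι ℂ j)
        (FreeAlgebra.ι ℂ j * FreeAlgebra.ι ℂ i)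

/-- The Hecke algebra `H_n(q)`. -/
abbrev Hecke (q : ℂ) (n : ℕ) : Type := RingQuot (HeckeRel q n)

/-- The stochastic generator with index `i`, for `1 ≤ i ≤ n - 1` (and `0` outside this range). -/
noncomputable def heckeSigma (q : ℂ) (n i : ℕ) : Hecke q n :=
  if h : 1 ≤ i ∧ i < n then
    RingQuot.mkAlgHom ℂ (HeckeRel q n) (FreeAlgebra.ι ℂ (⟨i, h⟩ : HeckeIndex n))
  else 0

/-- The stochastic `R`-element `R_i(u)`. -/
noncomputable def heckeR (q : ℂ) (n i : ℕ) (u : ℂ) : Hecke q n :=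
  ((1 - u) / (q ^ 2 - u)) • heckeSigma q n i + ((q ^ 2 - 1) / (q ^ 2 - u)) • (1 : Hecke q n)

/-- The stochastic symmetriser `S_[i,j]`: the product, ordered from left to right, over
`a = i, …, j - 1` of `R_a(q^(-2(a-i+1))) R_(a-1)(q^(-2(a-i))) ⋯ R_i(q^(-2))`.
In the code `a = i + s`, and the inner factors have index `b = i + s - t`. -/
noncomputable def heckeS (q : ℂ) (n i j : ℕ) : Hecke q n :=
  ((List.range (j - i)).map fun s =>
    ((List.range (s + 1)).map fun t =>
      heckeR q n (i + s - t) (q ^ (-2 * ((s : ℤ) - t + 1)))).prod).prod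

/-- `P^(a,b) = S_[1,a] S_[a+1,a+b]`, in the Hecke algebra on `n` strands. -/
noncomputable def heckeP (q : ℂ) (n a b : ℕ) : Hecke q n :=
  heckeS q n 1 a * heckeS q n (a + 1) (a + b)

/-- The fused stochastic `R`-element `R^(k,l)(u)` in the Hecke algebra on `k + l` strands:
`P^(k,l)`, times the rows `R_a(u q^(-2(1-a))) R_(a+1)(u q^(-2(2-a))) ⋯ R_(a+l-1)(u q^(-2(l-a)))`
for `a = k, k - 1, …, 1` from left to right, times `P^(l,k)`.
In the code the list indices are `a - 1` and `j - 1`. -/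
noncomputable def fusedR (q : ℂ) (k l : ℕ) (u : ℂ) : Hecke q (k + l) :=
  heckeP q (k + l) k l *
    ((List.range k).reverse.map fun a =>
      ((List.range l).map fun j =>
        heckeR q (k + l) (a + 1 + j) (u * q ^ (-2 * ((j : ℤ) - a)))).prod).prod *
    heckeP q (k + l) l k

/-! ### The stochastic representation on tensor powers of a two-dimensional space

The tensor power with `n` factors has the basis of words `Fin n → Fin 2`; the letters `0`, `1`
stand for the basis vectors `e_1`, `e_2`. -/

/-- Words of length `n` in two letters. -/
abbrev TWord (n : ℕ) : Type := Fin n → Fin 2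

/-- The word with the letters at positions `i` and `i + 1` (counted from `1`) exchanged. -/
def swapWord {n : ℕ} (i : HeckeIndex n) (w : TWord n) : TWord n :=
  w ∘ Equiv.swap (⟨i.1 - 1, by have := i.2; omega⟩ : Fin n) ⟨i.1, i.2.2⟩

/-- The stochastic `R`-matrix acting on the tensor factors `i` and `i + 1`. The entry in row `w`
and column `v` is the coefficient of `e_w` in the image of `e_v`. -/
def sigmaMatrix (q : ℂ) {n : ℕ} (i : HeckeIndex n) : Matrix (TWord n) (TWord n) ℂ :=
  Matrix.of fun w v =>
    if v ⟨i.1 - 1, by have := i.2; omega⟩ = v ⟨i.1, i.2.2⟩ then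
      (if w = v then 1 else 0)
    else if v ⟨i.1 - 1, by have := i.2; omega⟩ < v ⟨i.1, i.2.2⟩ then
      (if w = swapWord i v then 1 else 0) + (1 - q ^ 2) * (if w = v then 1 else 0)
    else
      q ^ 2 * (if w = swapWord i v then 1 else 0)

theorem swapWord_swapWord {n : ℕ} (i : HeckeIndex n) (w : TWord n) :
    swapWord i (swapWord i w) = w := by
  funext x
  simp [swapWord]

theorem swapWord_left {n : ℕ} (i : HeckeIndex n) (w : TWord n) (h : i.1 - 1 < n) :
    swapWord i w ⟨i.1 - 1, h⟩ = w ⟨i.1, i.2.2⟩ := by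
  simp [swapWord]

theorem swapWord_right {n : ℕ} (i : HeckeIndex n) (w : TWord n) (h : i.1 < n) :
    swapWord i w ⟨i.1, h⟩ = w ⟨i.1 - 1, by have := i.2; omega⟩ := by
  simp [swapWord]

theorem swapWord_other {n : ℕ} (i : HeckeIndex n) (w : TWord n) (x : Fin n)
    (h1 : x.1 ≠ i.1 - 1) (h2 : x.1 ≠ i.1) : swapWord i w x = w x := by
  simp only [swapWord, Function.comp]
  rw [Equiv.swap_apply_of_ne_of_ne] <;> simpa [Fin.ext_iff]

theorem sigmaMatrix_row (q : ℂ) {n : ℕ} (i : HeckeIndex n) (w v : TWord n) :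
    sigmaMatrix q i w v =
      if w ⟨i.1 - 1, by have := i.2; omega⟩ = w ⟨i.1, i.2.2⟩ then (if v = w then 1 else 0)
      else if w ⟨i.1 - 1, by have := i.2; omega⟩ < w ⟨i.1, i.2.2⟩ then
        (1 - q ^ 2) * (if v = w then 1 else 0) + q ^ 2 * (if v = swapWord i w then 1 else 0)
      else (if v = swapWord i w then 1 else 0) := by
  have hn : i.1 - 1 < n := by have := i.2; omega
  have hl := swapWord_left i w hn
  have hr := swapWord_right i w i.2.2
  simp only [sigmaMatrix, Matrix.of_apply]
  have key : (w = swapWord i v) = (v = swapWord i w) := by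
    apply propext
    constructor <;> (intro h; rw [h, swapWord_swapWord])
  simp only [key]
  by_cases h1 : v = w
  · subst h1
    by_cases h2 : v = swapWord i v
    · have h3 : v ⟨i.1 - 1, hn⟩ = v ⟨i.1, i.2.2⟩ := by rw [← hl, ← h2]
      simp [h3]
    · simp only [h2, if_true, if_false]
      split_ifs <;> simp
  · by_cases h2 : v = swapWord i w
    · have e1 : v ⟨i.1 - 1, hn⟩ = w ⟨i.1, i.2.2⟩ := by rw [h2, hl]
      have e2 : v ⟨i.1, i.2.2⟩ = w ⟨i.1 - 1, hn⟩ := by rw [h2, hr]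
      have h3 : w ⟨i.1 - 1, hn⟩ ≠ w ⟨i.1, i.2.2⟩ := by
        intro h
        apply h1
        rw [h2]
        funext x
        by_cases hx1 : x = ⟨i.1 - 1, hn⟩
        · rw [hx1, hl, h]
        by_cases hx2 : x = ⟨i.1, i.2.2⟩
        · rw [hx2, hr, h]
        exact swapWord_other i w x (fun h => hx1 (Fin.ext h)) (fun h => hx2 (Fin.ext h))
      have h1' : ¬ (w = v) := fun h => h1 h.symm
      rw [if_neg h1, if_pos h2, if_neg h1', e1, e2]
      generalize w ⟨i.1 - 1, hn⟩ = x at *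
      generalize w ⟨i.1, i.2.2⟩ = y at *
      rcases lt_or_gt_of_ne h3 with h | h
      · simp [h3, h3.symm, h, h.le]
      · simp [h3, h3.symm, h, h.le]
    · have h1' : ¬ (w = v) := fun h => h1 h.symm
      simp [h1, h1', h2]

theorem sigmaMatrix_mulVec (q : ℂ) {n : ℕ} (i : HeckeIndex n) (f : TWord n → ℂ) (w : TWord n) :
    (sigmaMatrix q i).mulVec f w =
      if w ⟨i.1 - 1, by have := i.2; omega⟩ = w ⟨i.1, i.2.2⟩ then f w
      else if w ⟨i.1 - 1, by have := i.2; omega⟩ < w ⟨i.1, i.2.2⟩ then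
        (1 - q ^ 2) * f w + q ^ 2 * f (swapWord i w)
      else f (swapWord i w) := by
  simp only [Matrix.mulVec, dotProduct, sigmaMatrix_row]
  split_ifs
  · simp
  · simp [add_mul, Finset.sum_add_distrib]
  · simp

theorem sigmaMatrix_quad (q : ℂ) {n : ℕ} (i : HeckeIndex n) :
    sigmaMatrix q i * sigmaMatrix q i =
      (1 - q ^ 2) • sigmaMatrix q i + (q ^ 2) • (1 : Matrix (TWord n) (TWord n) ℂ) := by
  have hn : i.1 - 1 < n := by have := i.2; omega
  apply Matrix.mulVec_injective
  funext f w
  rw [← Matrix.mulVec_mulVec, Matrix.add_mulVec, Matrix.smul_mulVec, Matrix.smul_mulVec,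
    Matrix.one_mulVec]
  simp only [Pi.add_apply, Pi.smul_apply, smul_eq_mul, sigmaMatrix_mulVec, swapWord_swapWord,
    swapWord_left i w hn, swapWord_right i w i.2.2]
  generalize w ⟨i.1 - 1, hn⟩ = x
  generalize w ⟨i.1, i.2.2⟩ = y
  rcases lt_trichotomy x y with h | h | h
  · simp [h, h.ne, h.ne', not_lt.mpr h.le]
  · simp [h]
    ring
  · simp [h, h.ne, h.ne', not_lt.mpr h.le]

theorem swapWord_braid {n : ℕ} (i j : HeckeIndex n) (h : j.1 = i.1 + 1) (w : TWord n) :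
    swapWord i (swapWord j (swapWord i w)) = swapWord j (swapWord i (swapWord j w)) := by
  have hn : i.1 - 1 < n := by have := i.2; omega
  have hj0 : (⟨j.1 - 1, by have := j.2; omega⟩ : Fin n) = ⟨i.1, i.2.2⟩ := by
    apply Fin.ext; simp [h]
  have hi := i.2
  have hj := j.2
  have a1 : ∀ v, swapWord i v ⟨i.1 - 1, hn⟩ = v ⟨i.1, i.2.2⟩ := fun v => swapWord_left i v hn
  have a2 : ∀ v, swapWord i v ⟨i.1, i.2.2⟩ = v ⟨i.1 - 1, hn⟩ := fun v => swapWord_right i v _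
  have a3 : ∀ v, swapWord i v ⟨j.1, j.2.2⟩ = v ⟨j.1, j.2.2⟩ :=
    fun v => swapWord_other i v _ (by simp; omega) (by simp; omega)
  have b1 : ∀ v, swapWord j v ⟨i.1, i.2.2⟩ = v ⟨j.1, j.2.2⟩ := fun v => by
    rw [← hj0]; exact swapWord_left j v _
  have b2 : ∀ v, swapWord j v ⟨j.1, j.2.2⟩ = v ⟨i.1, i.2.2⟩ := fun v => by
    rw [← hj0]; exact swapWord_right j v _
  have b3 : ∀ v, swapWord j v ⟨i.1 - 1, hn⟩ = v ⟨i.1 - 1, hn⟩ :=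
    fun v => swapWord_other j v _ (by simp; omega) (by simp; omega)
  funext x
  by_cases h1 : x = ⟨i.1 - 1, hn⟩
  · subst h1; simp only [a1, a3, b1, b3]
  by_cases h2 : x = ⟨i.1, i.2.2⟩
  · subst h2; simp only [a1, a2, a3, b1, b2, b3]
  by_cases h3 : x = ⟨j.1, j.2.2⟩
  · subst h3; simp only [a1, a2, a3, b1, b2, b3]
  have g1 : x.1 ≠ i.1 - 1 := fun e => h1 (Fin.ext e)
  have g2 : x.1 ≠ i.1 := fun e => h2 (Fin.ext e)
  have g3 : x.1 ≠ j.1 := fun e => h3 (Fin.ext e)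
  have g4 : x.1 ≠ j.1 - 1 := by omega
  simp only [swapWord_other i _ x g1 g2, swapWord_other j _ x g4 g3]

theorem sigmaMatrix_braid (q : ℂ) {n : ℕ} (i j : HeckeIndex n) (h : j.1 = i.1 + 1) :
    sigmaMatrix q i * sigmaMatrix q j * sigmaMatrix q i =
      sigmaMatrix q j * sigmaMatrix q i * sigmaMatrix q j := by
  have hn : i.1 - 1 < n := by have := i.2; omega
  have hj0 : (⟨j.1 - 1, by have := j.2; omega⟩ : Fin n) = ⟨i.1, i.2.2⟩ := by
    apply Fin.ext; simp [h]
  have hi := i.2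
  have hj := j.2
  apply Matrix.mulVec_injective
  funext f w
  have a1 : ∀ v, swapWord i v ⟨i.1 - 1, hn⟩ = v ⟨i.1, i.2.2⟩ := fun v => swapWord_left i v hn
  have a2 : ∀ v, swapWord i v ⟨i.1, i.2.2⟩ = v ⟨i.1 - 1, hn⟩ := fun v => swapWord_right i v _
  have a3 : ∀ v, swapWord i v ⟨j.1, j.2.2⟩ = v ⟨j.1, j.2.2⟩ :=
    fun v => swapWord_other i v _ (by simp; omega) (by simp; omega)
  have b1 : ∀ v, swapWord j v ⟨i.1, i.2.2⟩ = v ⟨j.1, j.2.2⟩ := fun v => by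
    rw [← hj0]; exact swapWord_left j v _
  have b2 : ∀ v, swapWord j v ⟨j.1, j.2.2⟩ = v ⟨i.1, i.2.2⟩ := fun v => by
    rw [← hj0]; exact swapWord_right j v _
  have b3 : ∀ v, swapWord j v ⟨i.1 - 1, hn⟩ = v ⟨i.1 - 1, hn⟩ :=
    fun v => swapWord_other j v _ (by simp; omega) (by simp; omega)
  simp only [← Matrix.mulVec_mulVec, sigmaMatrix_mulVec, hj0, a1, a2, a3, b1, b2, b3,
    swapWord_swapWord, swapWord_braid i j h]
  generalize w ⟨i.1 - 1, hn⟩ = x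
  generalize w ⟨i.1, i.2.2⟩ = y
  generalize w ⟨j.1, j.2.2⟩ = z
  fin_cases x <;> fin_cases y <;> fin_cases z <;> simp <;> ring

theorem swapWord_comm {n : ℕ} (i j : HeckeIndex n) (h : i.1 + 1 < j.1) (w : TWord n) :
    swapWord i (swapWord j w) = swapWord j (swapWord i w) := by
  have hi := i.2
  have hj := j.2
  funext x
  by_cases g : x.1 = i.1 - 1 ∨ x.1 = i.1
  · have g1 : ∀ v, swapWord j v x = v x :=
      fun v => swapWord_other j v x (by omega) (by omega)
    have hn : i.1 - 1 < n := by omega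
    rw [g1]
    rcases g with g | g
    · obtain rfl : x = ⟨i.1 - 1, hn⟩ := Fin.ext g
      rw [swapWord_left, swapWord_left]
      exact swapWord_other j w _ (by simp; omega) (by simp; omega)
    · obtain rfl : x = ⟨i.1, i.2.2⟩ := Fin.ext g
      rw [swapWord_right, swapWord_right]
      exact swapWord_other j w _ (by simp; omega) (by simp; omega)
  · push Not at g
    rw [swapWord_other i _ x g.1 g.2]
    by_cases g1 : x.1 = j.1 - 1
    · have hn : j.1 - 1 < n := by omega
      obtain rfl : x = ⟨j.1 - 1, hn⟩ := Fin.ext g1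
      rw [swapWord_left, swapWord_left]
      exact (swapWord_other i w _ (by simp; omega) (by simp; omega)).symm
    by_cases g2 : x.1 = j.1
    · obtain rfl : x = ⟨j.1, j.2.2⟩ := Fin.ext g2
      rw [swapWord_right, swapWord_right]
      exact (swapWord_other i w _ (by simp; omega) (by simp; omega)).symm
    rw [swapWord_other j _ x g1 g2, swapWord_other j _ x g1 g2, swapWord_other i _ x g.1 g.2]

theorem sigmaMatrix_comm (q : ℂ) {n : ℕ} (i j : HeckeIndex n) (h : i.1 + 1 < j.1) :
    sigmaMatrix q i * sigmaMatrix q j = sigmaMatrix q j * sigmaMatrix q i := by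
  have hi := i.2
  have hj := j.2
  have hn : i.1 - 1 < n := by omega
  have hm : j.1 - 1 < n := by omega
  apply Matrix.mulVec_injective
  funext f w
  have a1 : ∀ v, swapWord i v ⟨j.1 - 1, hm⟩ = v ⟨j.1 - 1, hm⟩ :=
    fun v => swapWord_other i v _ (by simp; omega) (by simp; omega)
  have a2 : ∀ v, swapWord i v ⟨j.1, j.2.2⟩ = v ⟨j.1, j.2.2⟩ :=
    fun v => swapWord_other i v _ (by simp; omega) (by simp; omega)
  have b1 : ∀ v, swapWord j v ⟨i.1 - 1, hn⟩ = v ⟨i.1 - 1, hn⟩ :=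
    fun v => swapWord_other j v _ (by simp; omega) (by simp; omega)
  have b2 : ∀ v, swapWord j v ⟨i.1, i.2.2⟩ = v ⟨i.1, i.2.2⟩ :=
    fun v => swapWord_other j v _ (by simp; omega) (by simp; omega)
  simp only [← Matrix.mulVec_mulVec, sigmaMatrix_mulVec, a1, a2, b1, b2, swapWord_comm i j h]
  split_ifs <;> ring

/-- The stochastic representation of the Hecke algebra on the `n`-th tensor power, written in
the basis of words: the generator with index `i` acts by `sigmaMatrix q i`. -/
noncomputable def heckeRep (q : ℂ) (n : ℕ) : Hecke q n →ₐ[ℂ] Matrix (TWord n) (TWord n) ℂ :=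
  RingQuot.liftAlgHom ℂ ⟨FreeAlgebra.lift ℂ (fun i : HeckeIndex n => sigmaMatrix q i), by
    intro x y hxy
    cases hxy with
    | quad i => simpa using sigmaMatrix_quad q i
    | braid i j h => simpa using sigmaMatrix_braid q i j h
    | comm i j h => simpa using sigmaMatrix_comm q i j h⟩

theorem heckeRep_sigma (q : ℂ) (n : ℕ) (i : HeckeIndex n) :
    heckeRep q n (heckeSigma q n i.1) = sigmaMatrix q i := by
  rw [heckeSigma, dif_pos i.2, heckeRep, RingQuot.liftAlgHom_mkAlgHom_apply,
    FreeAlgebra.lift_ι_apply]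

/-! ### The `q`-symmetrised subspaces and their bases -/

/-- The word of `e_1^(⊗ i) ⊗ e_2^(⊗ (a-i)) ⊗ e_1^(⊗ j) ⊗ e_2^(⊗ (n-a-j))`, for `i ≤ a` and
`j ≤ n - a`. -/
def blockWord (n a i j : ℕ) : TWord n := fun s =>
  if s.1 < a then (if s.1 < i then 0 else 1) else (if s.1 < a + j then 0 else 1)

/-- The matrix of `P^(a,b)` in the stochastic representation on `n` tensor factors. -/
noncomputable def projMatrix (q : ℂ) (n a b : ℕ) : Matrix (TWord n) (TWord n) ℂ :=
  heckeRep q n (heckeP q n a b)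

/-- The matrix of `R^(k,l)(z)` in the stochastic representation. -/
noncomputable def fusedRMatrix (q : ℂ) (k l : ℕ) (z : ℂ) :
    Matrix (TWord (k + l)) (TWord (k + l)) ℂ :=
  heckeRep q (k + l) (fusedR q k l z)

/-- The family `b` is a basis of the subspace `W`. -/
def IsBasisOf {ι V : Type*} [AddCommGroup V] [Module ℂ V] (b : ι → V) (W : Submodule ℂ V) : Prop :=
  LinearIndependent ℂ b ∧ Submodule.span ℂ (Set.range b) = W

/-! ### `q`-notation -/

/-- `[n]_(q^2) = (1 - q^(2n)) / (1 - q^2)`. -/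
noncomputable def qInt (q : ℂ) (n : ℕ) : ℂ := (1 - q ^ (2 * n)) / (1 - q ^ 2)

/-- `[n]_(q^2)! = [1] ⋯ [n]`. -/
noncomputable def qFact (q : ℂ) (n : ℕ) : ℂ := ∏ i ∈ Finset.range n, qInt q (i + 1)

/-- The `q^2`-binomial coefficient, zero unless `0 ≤ m ≤ n`. -/
noncomputable def qBinom (q : ℂ) (n m : ℤ) : ℂ :=
  if 0 ≤ m ∧ m ≤ n then
    qFact q n.toNat / (qFact q m.toNat * qFact q (n - m).toNat)
  else 0

/-- The Pochhammer symbol `(a; x)_n = (1 - a) (1 - a x) ⋯ (1 - a x^(n-1))`. -/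
noncomputable def qPoch (a x : ℂ) (n : ℕ) : ℂ := ∏ i ∈ Finset.range n, (1 - a * x ^ i)

/-- The coefficient `a_p^(k,l)(z)`. -/
noncomputable def aCoeff (q : ℂ) (k l p : ℕ) (z : ℂ) : ℂ :=
  qBinom q k p * q ^ (-2 * (l : ℤ) * p) *
    (qPoch (q ^ (-2 * (l : ℤ))) (q ^ 2) (k - p) * qPoch z (q ^ 2) p) /
      qPoch (z * q ^ (-2 * (l : ℤ))) (q ^ 2) k

/-- `J_m(r, s; s + δ, r - δ)`, written in its four arguments: here `x = s + δ`, `y = r - δ`,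
so `δ = x - s` and `m - s - δ = m - x`. It is used only for `r + s = x + y`; it vanishes
if `δ < 0`, because of the binomial coefficient. -/
noncomputable def jWeight (q : ℂ) (m r s x y : ℤ) : ℂ :=
  qBinom q r y * qPoch (q ^ (2 * (m - s))) (q ^ (-2 : ℤ)) (x - s).toNat *
    q ^ (2 * (m - x) * y)

/-- The explicit expression for the entry of `R^(k,l)(z)` with row index `(k', l')` and column
index `(lt, kt)`. -/
noncomputable def entryFormula (q : ℂ) (k l : ℕ) (z : ℂ) (k' l' lt kt : ℕ) : ℂ :=
  if k' + l' = lt + kt then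
    ∑ p ∈ Finset.range (k + 1), ∑ r ∈ Finset.range (p + 1), ∑ s ∈ Finset.range (l - k + p + 1),
      aCoeff q k l p z *
        (qBinom q ((k : ℤ) - p) ((k' : ℤ) - r) * qBinom q p r *
          q ^ (2 * (r : ℤ) * (k - p - k' + r)) / qBinom q k k') *
        (qBinom q ((k : ℤ) - p) ((l' : ℤ) - s) * qBinom q ((l : ℤ) - k + p) s *
          q ^ (2 * ((l' : ℤ) - s) * (l - k + p - s)) / qBinom q l l') *
        jWeight q ((l : ℤ) - k + p) r s ((lt : ℤ) - k' + r) ((kt : ℤ) - l' + s)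
  else 0

/-- The image of `e_1^(⊗ i) ⊗ e_2^(⊗ (a-i)) ⊗ e_1^(⊗ j) ⊗ e_2^(⊗ (b-j))` under `P^(a,b)` acting on
column vectors, multiplied by `binom(a, i) binom(b, j)`. -/
noncomputable def colVec (q : ℂ) (a b n : ℕ) (x : Fin (a + 1) × Fin (b + 1)) : TWord n → ℂ :=
  (qBinom q a x.1 * qBinom q b x.2) •
    (projMatrix q n a b).mulVec (Pi.single (blockWord n a x.1 x.2) 1)

/-- The image of `e_1^(⊗ i) ⊗ e_2^(⊗ (a-i)) ⊗ e_1^(⊗ j) ⊗ e_2^(⊗ (b-j))` under `P^(a,b)` acting on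
row vectors. -/
noncomputable def rowVec (q : ℂ) (a b n : ℕ) (x : Fin (a + 1) × Fin (b + 1)) : TWord n → ℂ :=
  Matrix.vecMul (Pi.single (blockWord n a x.1 x.2) 1) (projMatrix q n a b)

/-!
The symmetriser `P^(a,b)` is the projection onto the vectors fixed by all generators except the one
joining the two blocks (`IsHeckeFamily.mul_symL`, `IsHeckeFamily.symR_mul`). In the stochastic
representation a function on words is fixed by these generators precisely when it depends only on
the block contents, that is on the numbers of letters `e_1` in the two blocks. Hence the column
vectors `v_(i,j)` are the indicator functions of the block contents, the row vectors `π_(i,j)` are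
weights of total `1` proportional to `q ^ (2 * inversions)`, and `P^(a,b) = ∑ v_(i,j) π_(i,j)`
(`projMatrix_apply`, `colVec_eq`, `rowVec_apply`). Both forms of the theorem then reduce to the
single scalar identity `π_x X v_y = F(x, y)`, where `X` is the product of the `k` rows of
`R`-elements without the symmetrisers.

The identity is proved in two steps. The first one takes place in any algebra with Hecke
generators. Let `T_p` be the product of generators that makes a bundle of `p` strands cross
`l - k + p` strands, leaving `k - p` strands on either side. Then
`ψ X f = ∑ p, a_p(z) ψ T_p f` whenever `ψ` and `f` absorb the same generators as the symmetrisers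
(`IsHeckeFamily.mul_rRows_mul`). The proof is by induction on `k`, splitting off the rightmost row.
Expanded against `f`, a row is a combination of ascending products `σ_(j+1) ⋯ σ_l`
(`IsHeckeFamily.rRow_mul`), and each of them, multiplied by `T_p` from the left, becomes either
`T_p` with one crossed strand fewer or `T_(p+1)` once the generators absorbed by `ψ` and `f` are
dropped (`IsHeckeFamily.mul_crossing_mul_rRow`). The resulting recursion for the coefficients is
solved by `a_p(z)`, by the two `q`-Pascal identities (`aCoeff_succ_succ`).

The second step evaluates `π_x T_p v_y`. The stochastic generators move letters like a Markov chain,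
and one strand crossing `m` strands has an explicit transition law (`ascProd_mulVec`). Iterating it
gives the weights `J`, which satisfy the matching recursion (`jTrans_succ`, `crossing_mulVec`). It
remains to average over the words of the class `x`, cut into four blocks, which produces the
`q`-hypergeometric factors (`wordSum_four_blocks`). There the sum of the positions of the letters
`e_1` is used in place of the number of inversions; the two differ by a constant on each class,
and the former is additive over blocks.
-/

/-! ### Families satisfying the Hecke relations -/

/-- The elements `t 0, …, t (N - 1)` of an algebra satisfy the relations of the stochastic
generators of a Hecke algebra with parameter `Q`. Indices start at `0`, so that `t i` plays the
role of `σ_(i+1)`. -/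
structure IsHeckeFamily {A : Type*} [Ring A] [Algebra ℂ A] (Q : ℂ) (N : ℕ) (t : ℕ → A) :
    Prop where
  quad : ∀ i < N, t i * t i = (1 - Q) • t i + Q • (1 : A)
  braid : ∀ i, i + 1 < N → t i * t (i + 1) * t i = t (i + 1) * t i * t (i + 1)
  comm : ∀ i j, i + 1 < j → j < N → t i * t j = t j * t i

namespace IsHeckeFamily

variable {A : Type*} [Ring A] [Algebra ℂ A] {Q : ℂ} {N : ℕ} {t : ℕ → A}

/-- The relations are invariant under reversing products. -/
theorem op (h : IsHeckeFamily Q N t) : IsHeckeFamily Q N (fun i => MulOpposite.op (t i)) where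
  quad i hi := by
    rw [← MulOpposite.op_mul, h.quad i hi]; simp
  braid i hi := by
    simp only [← MulOpposite.op_mul, ← mul_assoc]
    rw [h.braid i hi]
  comm i j hij hj := by
    simp only [← MulOpposite.op_mul]
    rw [h.comm i j hij hj]

theorem commute (h : IsHeckeFamily Q N t) {i j : ℕ} (hi : i < N) (hj : j < N)
    (hij : i + 1 < j ∨ j + 1 < i) : Commute (t i) (t j) := by
  rcases hij with hij | hij
  · exact h.comm i j hij hj
  · exact (h.comm j i hij hi).symm

end IsHeckeFamily

section Products

variable {A : Type*} [Ring A]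

/-- The ascending product `t a * t (a + 1) * ⋯ * t (a + n - 1)`. -/
def ascProd (t : ℕ → A) : ℕ → ℕ → A
  | _, 0 => 1
  | a, n + 1 => t a * ascProd t (a + 1) n

variable {t : ℕ → A}

theorem ascProd_zero (a : ℕ) : ascProd t a 0 = 1 := rfl

theorem ascProd_succ (a n : ℕ) : ascProd t a (n + 1) = t a * ascProd t (a + 1) n := rfl

theorem ascProd_add (a m n : ℕ) :
    ascProd t a (m + n) = ascProd t a m * ascProd t (a + m) n := by
  induction m generalizing a with
  | zero => simp [ascProd_zero]
  | succ m ih =>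
    rw [Nat.succ_add, ascProd_succ, ascProd_succ, ih, mul_assoc]
    congr 3; omega

theorem ascProd_succ_right (a n : ℕ) : ascProd t a (n + 1) = ascProd t a n * t (a + n) := by
  rw [ascProd_add, ascProd_succ, ascProd_zero, mul_one]

theorem Commute.ascProd {x : A} {a n : ℕ} (h : ∀ j, a ≤ j → j < a + n → Commute x (t j)) :
    Commute x (ascProd t a n) := by
  induction n generalizing a with
  | zero => exact Commute.one_right x
  | succ n ih =>
    exact (h a le_rfl (by omega)).mul_right
      (ih fun j h1 h2 => h j (by omega) (by omega))

theorem mul_ascProd_of_fixed {f : A} {a n : ℕ} (h : ∀ j, a ≤ j → j < a + n → f * t j = f) :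
    f * ascProd t a n = f := by
  induction n generalizing a with
  | zero => simp [ascProd_zero]
  | succ n ih =>
    rw [ascProd_succ, ← mul_assoc, h a le_rfl (by omega)]
    exact ih fun j h1 h2 => h j (by omega) (by omega)

variable [Algebra ℂ A] {Q : ℂ} {N : ℕ}

/-- Moving a generator through an ascending product raises its index by one. -/
theorem IsHeckeFamily.ascProd_mul (h : IsHeckeFamily Q N t) {a n i : ℕ} (hN : a + n ≤ N)
    (hai : a ≤ i) (hi : i + 1 < a + n) :
    ascProd t a n * t i = t (i + 1) * ascProd t a n := by
  induction n generalizing a with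
  | zero => omega
  | succ n ih =>
    rcases hai.eq_or_lt with rfl | hlt
    · obtain ⟨m, rfl⟩ : ∃ m, n = m + 1 := ⟨n - 1, by omega⟩
      have hc : Commute (t a) (ascProd t (a + 1 + 1) m) :=
        Commute.ascProd fun j h1 h2 => h.commute (by omega) (by omega) (by omega)
      rw [ascProd_succ, ascProd_succ]
      calc t a * (t (a + 1) * ascProd t (a + 1 + 1) m) * t a
          = t a * t (a + 1) * (ascProd t (a + 1 + 1) m * t a) := by noncomm_ring
        _ = (t a * t (a + 1) * t a) * ascProd t (a + 1 + 1) m := by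
            rw [← hc.eq]; noncomm_ring
        _ = _ := by rw [h.braid a (by omega)]; noncomm_ring
    · have hc : Commute (t a) (t (i + 1)) := h.commute (by omega) (by omega) (by omega)
      rw [ascProd_succ, mul_assoc, ih (by omega) (by omega) (by omega), ← mul_assoc, hc.eq,
        mul_assoc]

/-! ### Coset sums and symmetrisers -/

/-- The sum `∑ j ∈ [0, m], Q ^ j • (t (a + j) * ⋯ * t (a + m - 1) * f)` over the minimal coset
representatives of a symmetric group on `m` letters in the one on `m + 1` letters. -/
def cosetSum (Q : ℂ) (t : ℕ → A) (f : A) : ℕ → ℕ → A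
  | _, 0 => f
  | a, m + 1 => ascProd t a (m + 1) * f + Q • cosetSum Q t f (a + 1) m

theorem cosetSum_commute_fixed {f x : A} {a m : ℕ}
    (hc : ∀ j, a ≤ j → j < a + m → Commute x (t j)) (hf : x * f = f) :
    x * cosetSum Q t f a m = cosetSum Q t f a m := by
  induction m generalizing a with
  | zero => exact hf
  | succ m ih =>
    rw [cosetSum, mul_add, ← mul_assoc, (Commute.ascProd hc).eq, mul_assoc, hf,
      mul_smul_comm, ih fun j h1 h2 => hc j (by omega) (by omega)]

/-- A coset sum is fixed by one more generator than `f`. -/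
theorem IsHeckeFamily.mul_cosetSum (h : IsHeckeFamily Q N t) {f : A} {a m : ℕ} (hN : a + m ≤ N)
    (hf : ∀ j, a ≤ j → j + 1 < a + m → t j * f = f) {i : ℕ} (hai : a ≤ i) (hi : i < a + m) :
    t i * cosetSum Q t f a m = cosetSum Q t f a m := by
  induction m generalizing a with
  | zero => omega
  | succ m ih =>
    rcases hai.eq_or_lt with rfl | hlt
    · cases m with
      | zero =>
        simp only [cosetSum, ascProd_succ, ascProd_zero, mul_one, mul_add, mul_smul_comm]
        rw [← mul_assoc, h.quad a (by omega), add_mul, smul_mul_assoc, smul_mul_assoc, one_mul]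
        module
      | succ m =>
        have h2 : t a * cosetSum Q t f (a + 1 + 1) m = cosetSum Q t f (a + 1 + 1) m :=
          cosetSum_commute_fixed
            (fun j h1 h2 => h.commute (by omega) (by omega) (by omega)) (hf a le_rfl (by omega))
        simp only [cosetSum, mul_add, mul_smul_comm, h2]
        rw [ascProd_succ (t := t) a]
        have e : t a * (t a * ascProd t (a + 1) (m + 1) * f) =
            (1 - Q) • (t a * ascProd t (a + 1) (m + 1) * f)
              + Q • (ascProd t (a + 1) (m + 1) * f) := by
          rw [← mul_assoc, ← mul_assoc, h.quad a (by omega)]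
          simp only [add_mul, smul_mul_assoc, one_mul]
        rw [e, ← mul_assoc]
        module
    · obtain ⟨i, rfl⟩ : ∃ i', i = i' + 1 := ⟨i - 1, by omega⟩
      rw [cosetSum, mul_add, mul_smul_comm, ih (by omega)
        (fun j h1 h2 => hf j (by omega) (by omega)) (by omega) (by omega), ← mul_assoc,
        ← h.ascProd_mul hN (by omega) (by omega), mul_assoc,
        hf i (by omega) (by omega)]

/-- The `R`-element `R(u)` built from the generator `t i`. It is meaningful for `u ≠ Q` only, where
its two coefficients have sum `1`. -/
noncomputable def rElt (Q : ℂ) (t : ℕ → A) (i : ℕ) (u : ℂ) : A :=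
  ((1 - u) / (Q - u)) • t i + ((Q - 1) / (Q - u)) • (1 : A)

theorem rElt_mul_of_fixed {f : A} {i : ℕ} {u : ℂ} (hu : Q - u ≠ 0) (hf : t i * f = f) :
    rElt Q t i u * f = f := by
  rw [rElt, add_mul, smul_mul_assoc, smul_mul_assoc, hf, one_mul, ← add_smul, ← add_div,
    sub_add_sub_comm, add_comm (1 : ℂ), add_sub_add_right_eq_sub, div_self hu, one_smul]

theorem mul_rElt_of_fixed {f : A} {i : ℕ} {u : ℂ} (hu : Q - u ≠ 0) (hf : f * t i = f) :
    f * rElt Q t i u = f := by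
  rw [rElt, mul_add, mul_smul_comm, mul_smul_comm, hf, mul_one, ← add_smul, ← add_div,
    sub_add_sub_comm, add_comm (1 : ℂ), add_sub_add_right_eq_sub, div_self hu, one_smul]

/-- The row `R_a(u) R_(a+1)(u / Q) ⋯ R_(a+n-1)(u / Q^(n-1))`. -/
noncomputable def rRow (Q : ℂ) (t : ℕ → A) : ℕ → ℕ → ℂ → A
  | _, 0, _ => 1
  | a, n + 1, u => rElt Q t a u * rRow Q t (a + 1) n (u * Q⁻¹)

theorem mul_rRow_of_fixed {f : A} {a n : ℕ} {u : ℂ} (hu : ∀ j < n, Q - u * Q⁻¹ ^ j ≠ 0)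
    (hf : ∀ j, a ≤ j → j < a + n → f * t j = f) : f * rRow Q t a n u = f := by
  induction n generalizing a u with
  | zero => simp [rRow]
  | succ n ih =>
    rw [rRow, ← mul_assoc, mul_rElt_of_fixed, ih]
    · intro j hj
      have := hu (j + 1) (by omega)
      rwa [pow_succ', ← mul_assoc] at this
    · exact fun j h1 h2 => hf j (by omega) (by omega)
    · simpa using hu 0 (by omega)
    · exact hf a le_rfl (by omega)

theorem Commute.rElt {x : A} {a : ℕ} {u : ℂ} (h : Commute x (t a)) :
    Commute x (rElt Q t a u) :=
  (h.smul_right _).add_right ((Commute.one_right x).smul_right _)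

theorem Commute.rRow {x : A} {a n : ℕ} {u : ℂ} (h : ∀ j, a ≤ j → j < a + n → Commute x (t j)) :
    Commute x (rRow Q t a n u) := by
  induction n generalizing a u with
  | zero => exact Commute.one_right x
  | succ n ih =>
    exact (h a le_rfl (by omega)).rElt.mul_right
      (ih fun j h1 h2 => h j (by omega) (by omega))

/-- A row acting on an element fixed by all but the last of its generators. The `R`-elements,
read from the right, either pass a strand on or stop it, and once it has stopped the remaining
ones are absorbed. The weights `Q ^ j` of `cosetSum` come out because the products of the passing
coefficients telescope. -/
theorem IsHeckeFamily.rRow_mul (h : IsHeckeFamily Q N t) (hQ : Q ≠ 0) {f : A} {a m : ℕ} {u : ℂ}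
    (hN : a + (m + 1) ≤ N) (hu : ∀ j < m + 1, Q - u * Q⁻¹ ^ j ≠ 0)
    (hf : ∀ j, a ≤ j → j < a + m → t j * f = f) :
    (1 - u * Q⁻¹ ^ (m + 1)) • (rRow Q t a (m + 1) u * f) =
      (Q⁻¹ ^ (m + 1) * (1 - u)) • (ascProd t a (m + 1) * f) +
        ((1 - Q⁻¹) * Q⁻¹ ^ m) • cosetSum Q t f (a + 1) m := by
  induction m generalizing a u with
  | zero =>
    have h0 : Q - u ≠ 0 := by simpa using hu 0 (by omega)
    simp only [rRow, rElt, ascProd, cosetSum, mul_one, zero_add, pow_one, pow_zero, add_mul,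
      smul_mul_assoc, one_mul, smul_add, smul_smul]
    congr 2
    · field_simp
    · field_simp
  | succ m ih =>
    have h0 : Q - u ≠ 0 := by simpa using hu 0 (by omega)
    have ih' := ih (a := a + 1) (u := u * Q⁻¹) (by omega)
      (fun j hj => by
        have := hu (j + 1) (by omega)
        rwa [pow_succ', ← mul_assoc] at this)
      (fun j h1 h2 => hf j (by omega) (by omega))
    have hc : t a * cosetSum Q t f (a + 1 + 1) m = cosetSum Q t f (a + 1 + 1) m :=
      cosetSum_commute_fixed
        (fun j h1 h2 => h.commute (by omega) (by omega) (by omega)) (hf a le_rfl (by omega))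
    have e : u * Q⁻¹ ^ (m + 1 + 1) = u * Q⁻¹ * Q⁻¹ ^ (m + 1) := by ring
    rw [rRow, mul_assoc, e, ← mul_smul_comm, ih', mul_add, mul_smul_comm, mul_smul_comm,
      rElt_mul_of_fixed h0 hc, cosetSum, rElt, add_mul, smul_mul_assoc, smul_mul_assoc, one_mul,
      ascProd_succ (t := t) a (m + 1)]
    simp only [smul_add, smul_smul, ← mul_assoc]
    have e1 : Q⁻¹ ^ (m + 1) * (1 - u * Q⁻¹) * ((1 - u) / (Q - u)) =
        Q⁻¹ ^ (m + 1 + 1) * (1 - u) := by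
      rw [pow_succ _ (m + 1)]
      field_simp
    have e2 : Q⁻¹ ^ (m + 1) * (1 - u * Q⁻¹) * ((Q - 1) / (Q - u)) =
        (1 - Q⁻¹) * Q⁻¹ ^ (m + 1) := by
      field_simp
    have e3 : (1 - Q⁻¹) * Q⁻¹ ^ (m + 1) * Q = (1 - Q⁻¹) * Q⁻¹ ^ m := by
      rw [pow_succ, mul_assoc, mul_assoc, inv_mul_cancel₀ hQ, mul_one]
    rw [e1, e2, e3]
    abel

/-- The symmetriser on `m + 1` strands as a product of rows, the longest one on the left. -/
noncomputable def symL (Q : ℂ) (t : ℕ → A) (a : ℕ) : ℕ → A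
  | 0 => 1
  | m + 1 => rRow Q t a (m + 1) Q⁻¹ * symL Q t a m

/-- The symmetriser is fixed by its generators: its longest row, acting on the symmetriser on one
strand fewer, amounts to a complete coset sum. -/
theorem IsHeckeFamily.mul_symL (h : IsHeckeFamily Q N t) (hQ : Q ≠ 0) {a m : ℕ} (hN : a + m ≤ N)
    (hu : ∀ j ≤ m, Q ^ (j + 1) ≠ 1) {i : ℕ} (hai : a ≤ i) (hi : i < a + m) :
    t i * symL Q t a m = symL Q t a m := by
  induction m generalizing i with
  | zero => omega
  | succ m ih =>
    have hu' : ∀ j ≤ m + 1, 1 - Q⁻¹ * Q⁻¹ ^ j ≠ 0 := fun j hj e => by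
      apply hu j hj
      rw [← pow_succ', inv_pow, sub_eq_zero, eq_comm] at e
      exact inv_eq_one.mp e
    have hr : ∀ j < m + 1, Q - Q⁻¹ * Q⁻¹ ^ j ≠ 0 := fun j hj e => by
      apply hu' (j + 1) (by omega)
      rw [pow_succ, ← mul_assoc, ← sub_eq_zero.mp e, mul_inv_cancel₀ hQ, sub_self]
    have hf : ∀ j, a ≤ j → j < a + m → t j * symL Q t a m = symL Q t a m :=
      fun j h1 h2 => ih (by omega) (fun j hj => hu j (by omega)) h1 h2
    have key := h.rRow_mul hQ (f := symL Q t a m) hN hr hf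
    -- for `u = Q⁻¹` the exceptional term of `rRow_mul` is the missing term of the coset sum
    have e : (Q⁻¹ ^ (m + 1) * (1 - Q⁻¹)) • (ascProd t a (m + 1) * symL Q t a m) +
        ((1 - Q⁻¹) * Q⁻¹ ^ m) • cosetSum Q t (symL Q t a m) (a + 1) m =
        (Q⁻¹ ^ (m + 1) * (1 - Q⁻¹)) • cosetSum Q t (symL Q t a m) a (m + 1) := by
      rw [cosetSum, smul_add, smul_smul]
      congr 2
      rw [pow_succ]
      field_simp
    rw [e] at key
    have hne := hu' (m + 1) le_rfl
    have : symL Q t a (m + 1) = (1 - Q⁻¹ * Q⁻¹ ^ (m + 1))⁻¹ •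
        (Q⁻¹ ^ (m + 1) * (1 - Q⁻¹)) • cosetSum Q t (symL Q t a m) a (m + 1) := by
      rw [← key, smul_smul, inv_mul_cancel₀ hne, one_smul, symL]
    rw [this, mul_smul_comm, mul_smul_comm,
      h.mul_cosetSum (f := symL Q t a m) hN (fun j h1 h2 => hf j h1 (by omega)) hai hi]

/-- The descending row `R_(a+n-1)(v / Q^(n-1)) ⋯ R_(a+1)(v / Q) R_a(v)`. -/
noncomputable def rRowRev (Q : ℂ) (t : ℕ → A) : ℕ → ℕ → ℂ → A
  | _, 0, _ => 1
  | a, n + 1, u => rRowRev Q t (a + 1) n (u * Q⁻¹) * rElt Q t a u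

/-- The symmetriser on `m + 1` strands as a product of descending rows, the longest one on the
right. -/
noncomputable def symR (Q : ℂ) (t : ℕ → A) (a : ℕ) : ℕ → A
  | 0 => 1
  | m + 1 => symR Q t a m * rRowRev Q t a (m + 1) Q⁻¹

theorem op_rElt (a : ℕ) (u : ℂ) :
    MulOpposite.op (rElt Q t a u) = rElt Q (fun i => MulOpposite.op (t i)) a u := by
  simp [rElt]

theorem op_rRowRev (a n : ℕ) (u : ℂ) :
    MulOpposite.op (rRowRev Q t a n u) = rRow Q (fun i => MulOpposite.op (t i)) a n u := by
  induction n generalizing a u with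
  | zero => simp [rRow, rRowRev]
  | succ n ih => rw [rRow, rRowRev, MulOpposite.op_mul, ih, op_rElt]

theorem op_symR (a m : ℕ) :
    MulOpposite.op (symR Q t a m) = symL Q (fun i => MulOpposite.op (t i)) a m := by
  induction m with
  | zero => simp [symL, symR]
  | succ m ih => rw [symL, symR, MulOpposite.op_mul, ih, op_rRowRev]

/-- The mirror image of `mul_symL`, obtained in the opposite algebra. -/
theorem IsHeckeFamily.symR_mul (h : IsHeckeFamily Q N t) (hQ : Q ≠ 0) {a m : ℕ} (hN : a + m ≤ N)
    (hu : ∀ j ≤ m, Q ^ (j + 1) ≠ 1) {i : ℕ} (hai : a ≤ i) (hi : i < a + m) :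
    symR Q t a m * t i = symR Q t a m := by
  apply MulOpposite.op_injective
  rw [MulOpposite.op_mul, op_symR]
  exact h.op.mul_symL hQ hN hu hai hi

theorem sub_inv_pow_ne_zero (hQ : Q ≠ 0) {m : ℕ} (hu : ∀ j ≤ m, Q ^ (j + 1) ≠ 1) {j : ℕ}
    (hj : j < m) : Q - Q⁻¹ * Q⁻¹ ^ j ≠ 0 := by
  intro e
  apply hu (j + 1) (by omega)
  rw [sub_eq_zero] at e
  calc Q ^ (j + 1 + 1) = Q * (Q ^ j * Q) := by ring
    _ = Q⁻¹ * Q⁻¹ ^ j * (Q ^ j * Q) := by rw [← e]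
    _ = 1 := by rw [inv_pow]; field_simp

theorem mul_symL_of_fixed (hQ : Q ≠ 0) {f : A} {a m : ℕ} (hu : ∀ j ≤ m, Q ^ (j + 1) ≠ 1)
    (hf : ∀ j, a ≤ j → j < a + m → f * t j = f) : f * symL Q t a m = f := by
  induction m with
  | zero => simp [symL]
  | succ m ih =>
    rw [symL, ← mul_assoc, mul_rRow_of_fixed (fun j hj => sub_inv_pow_ne_zero hQ hu hj) hf,
      ih (fun j hj => hu j (by omega)) (fun j h1 h2 => hf j h1 (by omega))]

theorem symR_mul_of_fixed (hQ : Q ≠ 0) {f : A} {a m : ℕ} (hu : ∀ j ≤ m, Q ^ (j + 1) ≠ 1)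
    (hf : ∀ j, a ≤ j → j < a + m → t j * f = f) : symR Q t a m * f = f := by
  apply MulOpposite.op_injective
  rw [MulOpposite.op_mul, op_symR]
  apply mul_symL_of_fixed hQ hu
  intro j h1 h2
  rw [← MulOpposite.op_mul, hf j h1 h2]

/-- The two products agree: `symR * symL` equals `symR`, because `symR` absorbs generators from the
right, and `symL`, because `symL` absorbs them from the left. -/
theorem IsHeckeFamily.symR_eq_symL (h : IsHeckeFamily Q N t) (hQ : Q ≠ 0) {a m : ℕ}
    (hN : a + m ≤ N) (hu : ∀ j ≤ m, Q ^ (j + 1) ≠ 1) : symR Q t a m = symL Q t a m := by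
  rw [← mul_symL_of_fixed hQ hu (fun j h1 h2 => h.symR_mul hQ hN hu h1 h2)]
  exact symR_mul_of_fixed hQ hu fun j h1 h2 => h.mul_symL hQ hN hu h1 h2

theorem Commute.symL {x : A} {a m : ℕ} (h : ∀ j, a ≤ j → j < a + m → Commute x (t j)) :
    Commute x (symL Q t a m) := by
  induction m with
  | zero => exact Commute.one_right x
  | succ m ih => exact (Commute.rRow h).mul_right (ih fun j h1 h2 => h j h1 (by omega))

end Products

/-! ### Identities for `q`-binomial coefficients and the weights -/

theorem qInt_ne_zero {q : ℂ} {n : ℕ} (h : q ^ (2 * n) ≠ 1) : qInt q n ≠ 0 := by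
  rcases eq_or_ne n 0 with rfl | hn
  · simp at h
  · apply div_ne_zero (sub_ne_zero.mpr h.symm)
    intro e
    apply h
    rw [pow_mul, ← sub_eq_zero.mp e, one_pow]

theorem qFact_succ (q : ℂ) (n : ℕ) : qFact q (n + 1) = qFact q n * qInt q (n + 1) :=
  Finset.prod_range_succ _ _

theorem qFact_ne_zero {q : ℂ} {l : ℕ} (hq : ∀ n : ℕ, 1 ≤ n → n ≤ l → q ^ (2 * n) ≠ 1) {n : ℕ}
    (hn : n ≤ l) : qFact q n ≠ 0 :=
  Finset.prod_ne_zero_iff.mpr fun i hi =>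
    qInt_ne_zero (hq _ (by omega) (by have := Finset.mem_range.mp hi; omega))

theorem qInt_add (q : ℂ) (m n : ℕ) : qInt q (m + n) = qInt q m + q ^ (2 * m) * qInt q n := by
  simp only [qInt]
  ring

theorem qBinom_of_nat (q : ℂ) (m n : ℕ) :
    qBinom q ((m + n : ℕ) : ℤ) m = qFact q (m + n) / (qFact q m * qFact q n) := by
  rw [qBinom, if_pos (by constructor <;> push_cast <;> omega)]
  congr 3
  omega

theorem qBinom_of_neg (q : ℂ) (n : ℤ) {m : ℤ} (hm : m < 0) : qBinom q n m = 0 :=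
  if_neg (by omega)

theorem qBinom_of_lt (q : ℂ) {n m : ℤ} (hm : n < m) : qBinom q n m = 0 :=
  if_neg (by omega)

theorem qBinom_symm (q : ℂ) (n m : ℤ) : qBinom q n (n - m) = qBinom q n m := by
  simp only [qBinom, sub_sub_cancel]
  rw [mul_comm (qFact q (n - m).toNat)]
  exact if_congr (by omega) rfl rfl

theorem qBinom_zero_right {q : ℂ} {l : ℕ} (hq : ∀ n : ℕ, 1 ≤ n → n ≤ l → q ^ (2 * n) ≠ 1)
    {n : ℕ} (hn : n ≤ l) : qBinom q n 0 = 1 := by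
  have := qBinom_of_nat q 0 n
  rw [zero_add, Nat.cast_zero] at this
  rw [this, show qFact q 0 = 1 from rfl, one_mul, div_self (qFact_ne_zero hq hn)]

theorem qBinom_self {q : ℂ} {l : ℕ} (hq : ∀ n : ℕ, 1 ≤ n → n ≤ l → q ^ (2 * n) ≠ 1)
    {n : ℕ} (hn : n ≤ l) : qBinom q n n = 1 := by
  rw [← qBinom_symm, sub_self, qBinom_zero_right hq hn]

theorem qBinom_ne_zero {q : ℂ} {l : ℕ} (hq : ∀ n : ℕ, 1 ≤ n → n ≤ l → q ^ (2 * n) ≠ 1)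
    {n m : ℕ} (hn : n ≤ l) (hm : m ≤ n) : qBinom q n m ≠ 0 := by
  obtain ⟨i, rfl⟩ := Nat.exists_eq_add_of_le hm
  rw [qBinom_of_nat]
  exact div_ne_zero (qFact_ne_zero hq hn)
    (mul_ne_zero (qFact_ne_zero hq (by omega)) (qFact_ne_zero hq (by omega)))

theorem qBinom_succ {q : ℂ} {l : ℕ} (hq : ∀ n : ℕ, 1 ≤ n → n ≤ l → q ^ (2 * n) ≠ 1)
    {n : ℕ} (hn : n + 1 ≤ l) (m : ℤ) :
    qBinom q ((n : ℤ) + 1) m = qBinom q n m + q ^ (2 * ((n : ℤ) + 1 - m)) * qBinom q n (m - 1) := by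
  rcases lt_trichotomy m 0 with hm | rfl | hm
  · rw [qBinom_of_neg _ _ hm, qBinom_of_neg _ _ hm, qBinom_of_neg _ _ (by omega)]
    simp
  · rw [qBinom_of_neg _ _ (show (0 : ℤ) - 1 < 0 by omega), qBinom_zero_right hq (by omega)]
    have := qBinom_zero_right hq hn
    push_cast at this
    simp [this]
  rcases lt_trichotomy m ((n : ℤ) + 1) with hm' | rfl | hm'
  · obtain ⟨j, rfl⟩ : ∃ j : ℕ, m = ((j + 1 : ℕ) : ℤ) := ⟨(m - 1).toNat, by omega⟩
    obtain ⟨i, rfl⟩ : ∃ i : ℕ, n = j + 1 + i := ⟨n - (j + 1), by omega⟩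
    have e1 := qBinom_of_nat q (j + 1) (i + 1)
    have e2 := qBinom_of_nat q (j + 1) i
    have e3 := qBinom_of_nat q j (i + 1)
    have c1 : ((j + 1 + i : ℕ) : ℤ) + 1 = ((j + 1 + (i + 1) : ℕ) : ℤ) := by push_cast; ring
    have c2 : ((j + 1 : ℕ) : ℤ) - 1 = j := by push_cast; ring
    have c3 : 2 * (((j + 1 + i : ℕ) : ℤ) + 1 - ((j + 1 : ℕ) : ℤ)) = ((2 * (i + 1) : ℕ) : ℤ) := by
      push_cast; ring
    have c4 : j + (i + 1) = j + 1 + i := by omega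
    rw [c4] at e3
    rw [c3, c1, c2, e1, e2, e3, zpow_natCast, ← add_assoc, qFact_succ q (j + 1 + i),
      show j + 1 + i + 1 = (i + 1) + (j + 1) by omega, qInt_add, qFact_succ q j, qFact_succ q i]
    have h1 := qFact_ne_zero hq (n := j) (by omega)
    have h2 := qFact_ne_zero hq (n := i) (by omega)
    have h3 := qInt_ne_zero (hq (j + 1) (by omega) (by omega))
    have h4 := qInt_ne_zero (hq (i + 1) (by omega) (by omega))
    field_simp
  · have := qBinom_self hq hn
    push_cast at this
    rw [this, qBinom_of_lt _ (by omega), add_sub_cancel_right, qBinom_self hq (by omega)]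
    simp
  · rw [qBinom_of_lt _ hm', qBinom_of_lt _ (by omega), qBinom_of_lt _ (by omega)]
    simp

theorem qBinom_succ' {q : ℂ} {l : ℕ} (hq : ∀ n : ℕ, 1 ≤ n → n ≤ l → q ^ (2 * n) ≠ 1)
    {n : ℕ} (hn : n + 1 ≤ l) (m : ℤ) :
    qBinom q ((n : ℤ) + 1) m = q ^ (2 * m) * qBinom q n m + qBinom q n (m - 1) := by
  have e1 : (n : ℤ) - (m - 1) = n + 1 - m := by ring
  have e2 : (n : ℤ) - m = n + 1 - m - 1 := by ring
  rw [← qBinom_symm, qBinom_succ hq hn, ← qBinom_symm q n m, ← qBinom_symm q n (m - 1),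
    sub_sub_cancel, add_comm, e1, e2]

theorem qPoch_succ (a x : ℂ) (n : ℕ) : qPoch a x (n + 1) = qPoch a x n * (1 - a * x ^ n) :=
  Finset.prod_range_succ _ _

theorem qPoch_succ' (a x : ℂ) (n : ℕ) : qPoch a x (n + 1) = (1 - a) * qPoch (a * x) x n := by
  rw [qPoch, Finset.prod_range_succ', pow_zero, mul_one, mul_comm]
  congr 1
  exact Finset.prod_congr rfl fun i _ => by rw [pow_succ', mul_assoc]

theorem aCoeff_zero_zero (q : ℂ) (l : ℕ) (z : ℂ) : aCoeff q 0 l 0 z = 1 := by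
  simp [aCoeff, qBinom, qFact, qPoch]

theorem aCoeff_succ_zero {q : ℂ} {l : ℕ} (hq0 : q ≠ 0)
    (hq : ∀ n : ℕ, 1 ≤ n → n ≤ l → q ^ (2 * n) ≠ 1)
    {k : ℕ} (hk : k + 1 ≤ l) {z : ℂ} (hz : 1 - z * q ^ (-2 * (l : ℤ)) ≠ 0) :
    (1 - z * q ^ (-2 * (l : ℤ))) * aCoeff q (k + 1) l 0 z =
      (1 - q ^ (-2 * ((l : ℤ) - k))) * aCoeff q k l 0 (z * q ^ 2) := by
  have h1 := qBinom_zero_right hq (n := k) (by omega)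
  have h2 := qBinom_zero_right hq hk
  have e1 : z * q ^ 2 * q ^ (-2 * (l : ℤ)) = z * q ^ (-2 * (l : ℤ)) * q ^ 2 := by ring
  have e2 : q ^ (-2 * (l : ℤ)) * (q ^ 2) ^ k = q ^ (-2 * ((l : ℤ) - k)) := by
    rw [← pow_mul, ← zpow_natCast, ← zpow_add₀ hq0]
    congr 1; push_cast; ring
  simp only [aCoeff, Nat.sub_zero, Nat.cast_zero, h1, h2,
    qPoch_succ' (z * q ^ (-2 * (l : ℤ))) _ k, e1]
  rw [← e2, qPoch_succ]
  simp only [qPoch, Finset.range_zero, Finset.prod_empty]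
  rw [mul_div_assoc', mul_div_mul_left _ _ hz]
  ring

/-- The recursion for the coefficients when one row is split off. Comparing the powers of `z`, it
consists of the two `q`-Pascal identities. -/
theorem aCoeff_succ_succ {q : ℂ} {l : ℕ} (hq0 : q ≠ 0)
    (hq : ∀ n : ℕ, 1 ≤ n → n ≤ l → q ^ (2 * n) ≠ 1)
    {k p : ℕ} (hk : k + 1 ≤ l) (hp : p ≤ k) {z : ℂ}
    (hz : 1 - z * q ^ (-2 * (l : ℤ)) ≠ 0) :
    (1 - z * q ^ (-2 * (l : ℤ))) * aCoeff q (k + 1) l (p + 1) z =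
      (1 - q ^ (-2 * ((l : ℤ) - k + (p + 1)))) * aCoeff q k l (p + 1) (z * q ^ 2) +
        (q ^ (-2 * ((l : ℤ) - k + p)) - z * q ^ (-2 * (l : ℤ))) * aCoeff q k l p (z * q ^ 2) := by
  have b1 := qBinom_succ hq hk ((p : ℤ) + 1)
  have b2 := qBinom_succ' hq hk ((p : ℤ) + 1)
  rw [add_sub_cancel_right] at b1 b2
  have e1 : z * q ^ 2 * q ^ (-2 * (l : ℤ)) = z * q ^ (-2 * (l : ℤ)) * q ^ 2 := by ring
  have e3 : q ^ (-2 * ((l : ℤ) - k + p)) =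
      q ^ (-2 * (l : ℤ)) * q ^ (2 * ((k : ℤ) + 1 - (p + 1))) := by
    rw [← zpow_add₀ hq0]
    congr 1; ring
  have e4 : q ^ (-2 * (l : ℤ) * ((p + 1 : ℕ) : ℤ)) =
      q ^ (-2 * (l : ℤ) * (p : ℤ)) * q ^ (-2 * (l : ℤ)) := by
    rw [← zpow_add₀ hq0]
    congr 1; push_cast; ring
  have e5 : (q ^ 2) ^ (p + 1) = q ^ (2 * ((p : ℤ) + 1)) := by
    rw [← pow_mul, ← zpow_natCast]; congr 1
  have e6 : qPoch (z * q ^ 2) (q ^ 2) (p + 1) =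
      qPoch (z * q ^ 2) (q ^ 2) p * (1 - z * q ^ (2 * ((p : ℤ) + 1))) := by
    rw [qPoch_succ, ← e5]; ring
  -- for `p = k` the truncated subtraction is harmless, since the binomial coefficient vanishes
  have hpoch : (1 - q ^ (-2 * ((l : ℤ) - k + (p + 1)))) *
        (qBinom q k ((p : ℤ) + 1) * qPoch (q ^ (-2 * (l : ℤ))) (q ^ 2) (k - (p + 1))) =
      qBinom q k ((p : ℤ) + 1) * qPoch (q ^ (-2 * (l : ℤ))) (q ^ 2) (k - p) := by
    rcases hp.eq_or_lt with rfl | hlt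
    · rw [qBinom_of_lt _ (by omega)]; simp
    · obtain ⟨n, hn⟩ : ∃ n, k - p = n + 1 := ⟨k - p - 1, by omega⟩
      have hn' : k - (p + 1) = n := by omega
      have e2 : q ^ (-2 * (l : ℤ)) * (q ^ 2) ^ n = q ^ (-2 * ((l : ℤ) - k + (p + 1))) := by
        rw [← pow_mul, ← zpow_natCast, ← zpow_add₀ hq0]
        congr 1; push_cast [← hn']; rw [Nat.cast_sub (by omega)]; push_cast; ring
      rw [hn, hn', qPoch_succ, e2]
      ring
  -- the coefficients of `z ^ 0` and `z ^ 1` are the two Pascal identities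
  have hnum : (1 - z) * qBinom q ((k : ℤ) + 1) ((p : ℤ) + 1) =
      qBinom q k ((p : ℤ) + 1) * (1 - z * q ^ (2 * ((p : ℤ) + 1))) +
        (q ^ (2 * ((k : ℤ) + 1 - (p + 1))) - z) * qBinom q k p := by
    linear_combination b1 - z * b2
  simp only [aCoeff, Nat.add_sub_add_right, Nat.cast_succ, e1, e3, e6] at *
  rw [qPoch_succ' _ _ k, qPoch_succ' _ _ p, mul_div_assoc', mul_div_mul_left _ _ hz, mul_div_assoc',
    mul_div_assoc', ← add_div, e4]
  congr 1
  linear_combination (q ^ (-2 * (l : ℤ) * (p : ℤ)) * q ^ (-2 * (l : ℤ)) *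
      qPoch (z * q ^ 2) (q ^ 2) p) *
    (qPoch (q ^ (-2 * (l : ℤ))) (q ^ 2) (k - p) * hnum
      - (1 - z * q ^ (2 * ((p : ℤ) + 1))) * hpoch)

/-- The weights `J_m(r, s; x, y)` with the conservation law `r + s = x + y` built in. -/
noncomputable def jTrans (q : ℂ) (m r s x y : ℤ) : ℂ :=
  if r + s = x + y then jWeight q m r s x y else 0

/-- With no letters `0` in the crossing bundle nothing changes. -/
theorem jTrans_zero (q : ℂ) (m s x y : ℤ) :
    jTrans q m 0 s x y = if s = x ∧ y = 0 then 1 else 0 := by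
  rw [jTrans]
  rcases eq_or_ne y 0 with rfl | hy
  · have : (0 + s = x + 0) = (s = x ∧ (0 : ℤ) = 0) := by simp
    simp only [this]
    split_ifs with h
    · obtain ⟨rfl, -⟩ := h
      simp [jWeight, qBinom, qFact, qPoch]
    · rfl
  · rw [if_neg (fun h : s = x ∧ y = 0 => hy h.2)]
    split_ifs with h
    · have : qBinom q 0 y = 0 := by
        rcases lt_or_gt_of_ne hy with h | h
        · exact qBinom_of_neg _ _ h
        · exact qBinom_of_lt _ h
      simp [jWeight, this]
    · rfl

/-- The recursion of the transition weights in the first letter `0` of the crossing bundle: either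
it passes the `m` strands, or it is left behind among them. -/
theorem jTrans_succ {q : ℂ} {l : ℕ} (hq0 : q ≠ 0)
    (hq : ∀ n : ℕ, 1 ≤ n → n ≤ l → q ^ (2 * n) ≠ 1) {r : ℕ} (hr : r + 1 ≤ l) (m s x y : ℤ) :
    jTrans q m (r + 1) s x y =
      q ^ (2 * (m - s)) * jTrans q m r s x (y - 1) +
        (1 - q ^ (2 * (m - s))) * jTrans q m r (s + 1) x y := by
  by_cases h : (r : ℤ) + 1 + s = x + y
  · have hs : s = x + y - r - 1 := by omega
    rw [jTrans, jTrans, jTrans, if_pos h, if_pos (by omega), if_pos (by omega)]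
    simp only [jWeight]
    rw [qBinom_succ hq hr y]
    rcases lt_or_ge (r : ℤ) y with hy | hy
    · rw [qBinom_of_lt q hy]
      rcases eq_or_ne y (r + 1) with rfl | hy'
      · have : (x - s).toNat = 0 := by omega
        rw [this]
        have e : q ^ (2 * (m - x) * ((r : ℤ) + 1)) =
            q ^ (2 * (m - s)) * q ^ (2 * (m - x) * ((r : ℤ) + 1 - 1)) := by
          rw [← zpow_add₀ hq0]; congr 1
          have : s = x := by omega
          rw [this]; ring
        rw [e]
        simp only [qPoch, Finset.range_zero, Finset.prod_empty, add_sub_cancel_right,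
          sub_self, mul_zero, zpow_zero]
        have : (x - (s + 1)).toNat = 0 := by omega
        simp only [this, Finset.range_zero, Finset.prod_empty]
        ring
      · rw [qBinom_of_lt q (show (r : ℤ) < y - 1 by omega)]
        simp
    · obtain ⟨d, hd⟩ : ∃ d : ℕ, x - s = d + 1 := ⟨(x - s - 1).toNat, by omega⟩
      have h1 : (x - s).toNat = d + 1 := by omega
      have h2 : (x - (s + 1)).toNat = d := by omega
      have e1 : q ^ (2 * (m - (s + 1))) = q ^ (2 * (m - s)) * q ^ (-2 : ℤ) := by
        rw [← zpow_add₀ hq0]; congr 1; ring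
      rw [h1, h2, e1, qPoch_succ']
      have e2 : q ^ (2 * ((r : ℤ) + 1 - y)) * q ^ (2 * (m - x) * y) =
          q ^ (2 * (m - s)) * q ^ (2 * (m - x) * (y - 1)) := by
        rw [← zpow_add₀ hq0, ← zpow_add₀ hq0]; congr 1
        rw [hs]; ring
      linear_combination (qBinom q r (y - 1) * ((1 - q ^ (2 * (m - s))) *
        qPoch (q ^ (2 * (m - s)) * q ^ (-2 : ℤ)) (q ^ (-2 : ℤ)) d)) * e2
  · rw [jTrans, jTrans, jTrans, if_neg h, if_neg (by omega), if_neg (by omega)]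
    simp

/-! ### Reduction of the fused `R`-element to strand crossings -/

section Fusion

variable {A : Type*} [Ring A]

/-- The product `(t (o+p-1) ⋯ t (o+p+m-2)) ⋯ (t (o+1) ⋯ t (o+m)) (t o ⋯ t (o+m-1))`: it makes a
bundle of `p` strands, the first of which has position `o`, cross the next `m` strands. -/
def crossing (t : ℕ → A) : ℕ → ℕ → ℕ → A
  | _, 0, _ => 1
  | o, p + 1, m => crossing t (o + 1) p m * ascProd t o m

variable {t : ℕ → A}

/-- If the last of the `m` crossed strands leaves through generators fixing `f`, it can be
dropped. -/
theorem crossing_succ_mul_of_fixed [Algebra ℂ A] {Q : ℂ} {N : ℕ} (h : IsHeckeFamily Q N t) {f : A}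
    {o p m : ℕ} (hN : o + p + m ≤ N) (hf : ∀ j, o + m ≤ j → j < o + m + p → t j * f = f) :
    crossing t o p (m + 1) * f = crossing t o p m * f := by
  induction p generalizing o f with
  | zero => rfl
  | succ p ih =>
    have e : ascProd t o (m + 1) * f = ascProd t o m * f := by
      rw [ascProd_succ_right, mul_assoc, hf _ le_rfl (by omega)]
    rw [crossing, mul_assoc, e, ih (by omega), crossing, mul_assoc]
    intro j h1 h2
    have hc : Commute (t j) (ascProd t o m) :=
      Commute.ascProd fun i h3 h4 => h.commute (by omega) (by omega) (by omega)
    rw [← mul_assoc, hc.eq, mul_assoc, hf j (by omega) (by omega)]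

theorem Commute.crossing {x : A} {o p m : ℕ}
    (h : ∀ j, o ≤ j → j + 1 < o + p + m → Commute x (t j)) :
    Commute x (crossing t o p m) := by
  induction p generalizing o with
  | zero => exact Commute.one_right x
  | succ p ih =>
    exact (ih fun j h1 h2 => h j (by omega) (by omega)).mul_right
      (Commute.ascProd fun j h1 h2 => h j (by omega) (by omega))

/-- A crossing transports the generators acting among the `m` crossed strands. -/
theorem IsHeckeFamily.crossing_mul [Algebra ℂ A] {Q : ℂ} {N : ℕ} (h : IsHeckeFamily Q N t)
    {o p m i : ℕ} (hN : o + p + m ≤ N + 1) (hp : 1 ≤ p) (hoi : o ≤ i) (hi : i + 1 < o + m) :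
    crossing t o p m * t i = t (i + p) * crossing t o p m := by
  induction p generalizing o i with
  | zero => omega
  | succ p ih =>
    rw [crossing, mul_assoc, h.ascProd_mul (by omega) hoi hi, ← mul_assoc]
    rcases Nat.eq_zero_or_pos p with rfl | hp'
    · simp [crossing]
    · rw [ih (by omega) hp' (by omega) (by omega), mul_assoc]
      congr 2; omega

variable [Algebra ℂ A] {Q : ℂ} {N : ℕ}

/-- A coset sum all of whose terms agree after multiplication by `ψ`. -/
theorem mul_cosetSum_const {B f ψ : A} {a m : ℕ}
    (h : ∀ j ≤ m, ψ * (ascProd t (a + j) (m - j) * f) = B) :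
    (Q - 1) • (ψ * cosetSum Q t f a m) = (Q ^ (m + 1) - 1) • B := by
  induction m generalizing a with
  | zero =>
    have := h 0 le_rfl
    simp only [Nat.sub_zero, ascProd_zero, one_mul] at this
    rw [cosetSum, this, zero_add, pow_one]
  | succ m ih =>
    have h0 := h 0 (by omega)
    have := ih (a := a + 1) fun j hj => by
      have := h (j + 1) (by omega)
      rwa [Nat.add_sub_add_right, ← add_assoc, add_right_comm] at this
    rw [cosetSum, mul_add, mul_smul_comm, smul_add, smul_comm, this]
    simp only [Nat.sub_zero, add_zero] at h0
    rw [h0, smul_smul, ← add_smul]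
    congr 1; ring

/-- A coset sum whose first `n` terms agree after multiplication by `ψ`. -/
theorem mul_cosetSum_split {B f ψ : A} {a n m : ℕ}
    (h : ∀ j < n, ψ * (ascProd t (a + j) (n + m - j) * f) = B) :
    (Q - 1) • (ψ * cosetSum Q t f a (n + m)) =
      (Q ^ n - 1) • B + Q ^ n • (Q - 1) • (ψ * cosetSum Q t f (a + n) m) := by
  induction n generalizing a with
  | zero => simp
  | succ n ih =>
    have h0 := h 0 (by omega)
    have := ih (a := a + 1) fun j hj => by
      have := h (j + 1) (by omega)
      rwa [show n + 1 + m - (j + 1) = n + m - j by omega, ← add_assoc, add_right_comm] at this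
    rw [Nat.succ_add, cosetSum, mul_add, mul_smul_comm, smul_add, smul_comm (Q - 1) Q, this]
    simp only [Nat.sub_zero, add_zero, Nat.succ_add] at h0
    rw [h0, show a + 1 + n = a + (n + 1) by omega]
    module

/-- The `k` rows of length `l` of the fused `R`-element, without the symmetrisers; the row
starting at position `o + a` has spectral parameter `z * Q ^ a`. -/
noncomputable def rRows (Q : ℂ) (t : ℕ → A) (l : ℕ) : ℕ → ℕ → ℂ → A
  | _, 0, _ => 1
  | o, k + 1, z => rRows Q t l (o + 1) k (z * Q) * rRow Q t o l z

/-- One more row acting after a crossing. Modulo the generators fixing `ψ` and `f`, every term of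
the row either enlarges the crossing bundle by one strand or drops one of the crossed strands. -/
theorem IsHeckeFamily.mul_crossing_mul_rRow (h : IsHeckeFamily Q N t) (hQ : Q ≠ 0) {ψ f : A}
    {o k l p : ℕ} {z : ℂ} (hkl : k + 1 ≤ l) (hp : p ≤ k) (hN : o + k + l ≤ N)
    (hz : ∀ j < l, Q - z * Q⁻¹ ^ j ≠ 0)
    (hψ : ∀ i, o ≤ i → i < o + k + l → i ≠ o + k → ψ * t i = ψ)
    (hf : ∀ i, o ≤ i → i < o + k + l → i ≠ o + l - 1 → t i * f = f) :
    (1 - z * Q⁻¹ ^ l) • (ψ * crossing t (o + 1 + k - p) p (l - k + p) * (rRow Q t o l z * f)) =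
      (1 - Q⁻¹ ^ (l - k + p)) • (ψ * crossing t (o + (k + 1) - p) p (l - (k + 1) + p) * f) +
      (Q⁻¹ ^ (l - k + p) - z * Q⁻¹ ^ l) •
        (ψ * crossing t (o + (k + 1) - (p + 1)) (p + 1) (l - (k + 1) + (p + 1)) * f) := by
  obtain ⟨d, rfl⟩ : ∃ d, k = p + d := ⟨k - p, by omega⟩
  obtain ⟨c, rfl⟩ : ∃ c, l = p + d + c + 1 := ⟨l - (p + d) - 1, by omega⟩
  have i1 : o + 1 + (p + d) - p = o + d + 1 := by omega
  have i2 : p + d + c + 1 - (p + d) + p = p + c + 1 := by omega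
  have i3 : o + (p + d + 1) - p = o + d + 1 := by omega
  have i4 : p + d + c + 1 - (p + d + 1) + p = p + c := by omega
  have i5 : o + (p + d + 1) - (p + 1) = o + d := by omega
  have i6 : p + d + c + 1 - (p + d + 1) + (p + 1) = p + c + 1 := by omega
  rw [i1, i2, i3, i4, i5, i6]
  set T := crossing t (o + d + 1) p (p + c + 1) with hT
  set B₀ := ψ * crossing t (o + d + 1) p (p + c) * f with hB₀
  set B₁ := ψ * crossing t (o + d) (p + 1) (p + c + 1) * f with hB₁
  -- dropping the last crossed strand
  have hT0 : ψ * T * f = B₀ := by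
    rw [hB₀, mul_assoc, mul_assoc, hT, crossing_succ_mul_of_fixed h (by omega)]
    intro j h1 h2
    exact hf j (by omega) (by omega) (by omega)
  have hT1 : ψ * T * (ascProd t (o + d) (p + c + 1) * f) = B₁ := by
    rw [hB₁, crossing, ← mul_assoc, ← mul_assoc, hT]
  -- generators among the crossed strands are transported to generators fixing `ψ`
  have hin : ∀ j, o + d + 1 ≤ j → j < o + d + (p + c + 1) → ψ * T * t j = ψ * T := by
    intro j h1 h2
    rw [mul_assoc, hT]
    rcases Nat.eq_zero_or_pos p with rfl | hp'
    · simp only [crossing, one_mul, mul_one]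
      exact hψ j (by omega) (by omega) (by omega)
    · rw [h.crossing_mul (by omega) hp' (by omega) (by omega), ← mul_assoc,
        hψ (j + p) (by omega) (by omega) (by omega)]
  -- generators to the left of the crossing commute with it
  have hout : ∀ j, o ≤ j → j < o + d → ψ * T * t j = ψ * T := by
    intro j h1 h2
    have hc : Commute (t j) T :=
      Commute.crossing fun i h3 h4 => h.commute (by omega) (by omega) (by omega)
    rw [mul_assoc, ← hc.eq, ← mul_assoc, hψ j h1 (by omega) (by omega)]
  have hbig : ∀ j ≤ d, ψ * T * (ascProd t (o + j) (p + d + c + 1 - j) * f) = B₁ := by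
    intro j hj
    have e : p + d + c + 1 - j = (d - j) + (p + c + 1) := by omega
    rw [e, ascProd_add, mul_assoc (ascProd t _ _), ← mul_assoc (ψ * T), mul_ascProd_of_fixed, ← hT1]
    · congr 3; omega
    · intro i h1 h2
      exact hout i (by omega) (by omega)
  have hsmall : ∀ j ≤ p + c,
      ψ * T * (ascProd t (o + 1 + d + j) (p + c - j) * f) = B₀ := by
    intro j hj
    rw [← mul_assoc, mul_ascProd_of_fixed, hT0]
    intro i h1 h2
    exact hin i (by omega) (by omega)
  have hsplit := mul_cosetSum_split (Q := Q) (t := t) (ψ := ψ * T) (f := f) (B := B₁)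
    (a := o + 1) (n := d) (m := p + c) fun j hj => by
      have := hbig (j + 1) (by omega)
      rwa [show p + d + c + 1 - (j + 1) = d + (p + c) - j by omega, ← add_assoc,
        add_right_comm] at this
  rw [mul_cosetSum_const hsmall] at hsplit
  have key := congrArg (fun x => ψ * T * x) (h.rRow_mul hQ (f := f) (a := o) (m := p + d + c)
    (u := z) (by omega) hz fun j h1 h2 => hf j h1 (by omega) (by omega))
  simp only [mul_add, mul_smul_comm] at key
  rw [key, show o = o + 0 by omega]
  rw [show ascProd t (o + 0) (p + d + c + 1) = ascProd t (o + 0) (p + d + c + 1 - 0) from rfl,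
    hbig 0 (by omega)]
  have e : (1 - Q⁻¹) * Q⁻¹ ^ (p + d + c) = Q⁻¹ ^ (p + d + c + 1) * (Q - 1) := by
    rw [pow_succ]; field_simp
  rw [e, mul_smul _ (Q - 1), show p + d + c = d + (p + c) by omega, add_zero, hsplit, smul_add,
    smul_smul, smul_smul, smul_smul]
  have e1 : Q⁻¹ ^ (d + (p + c) + 1) * Q ^ d = Q⁻¹ ^ (p + c + 1) := by
    rw [add_assoc, pow_add, mul_right_comm, ← mul_pow, inv_mul_cancel₀ hQ, one_pow, one_mul]
  have e2 : Q⁻¹ ^ (p + c + 1) * Q ^ (p + c + 1) = 1 := by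
    rw [← mul_pow, inv_mul_cancel₀ hQ, one_pow]
  rw [e1, mul_sub _ (Q ^ d), mul_sub _ (Q ^ (p + c + 1)), e1, e2]
  module

/-- The rows of the fused `R`-element, between `ψ` and `f` fixed by the generators that the
symmetrisers absorb, are a combination of strand crossings. -/
theorem IsHeckeFamily.mul_rRows_mul {q : ℂ} (h : IsHeckeFamily (q ^ 2) N t) (hq0 : q ≠ 0)
    {ψ f : A} {o k l : ℕ} {z : ℂ} (hq : ∀ n : ℕ, 1 ≤ n → n ≤ l → q ^ (2 * n) ≠ 1)
    (hkl : k ≤ l) (hN : o + k + l ≤ N + 1)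
    (hz : ∀ a < k, ∀ j < l, q ^ 2 - z * (q ^ 2) ^ a * (q ^ 2)⁻¹ ^ j ≠ 0)
    (hψ : ∀ i, o ≤ i → i + 1 < o + k + l → i + 1 ≠ o + k → ψ * t i = ψ)
    (hf : ∀ i, o ≤ i → i + 1 < o + k + l → i + 1 ≠ o + l → t i * f = f) :
    ψ * rRows (q ^ 2) t l o k z * f = ∑ p ∈ Finset.range (k + 1),
      aCoeff q k l p z • (ψ * crossing t (o + k - p) p (l - k + p) * f) := by
  induction k generalizing o z f with
  | zero => simp [rRows, crossing, aCoeff_zero_zero]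
  | succ k ih =>
    have hQ : q ^ 2 ≠ 0 := pow_ne_zero _ hq0
    have hz0 : ∀ j < l, q ^ 2 - z * (q ^ 2)⁻¹ ^ j ≠ 0 := fun j hj => by
      simpa using hz 0 (by omega) j hj
    have epow : ∀ n : ℕ, (q ^ 2)⁻¹ ^ n = q ^ (-2 * (n : ℤ)) := fun n => by
      rw [inv_pow, ← pow_mul, ← zpow_natCast, ← zpow_neg]
      congr 1
    have hne : 1 - z * q ^ (-2 * (l : ℤ)) ≠ 0 := by
      intro e
      apply hz0 (l - 1) (by omega)
      obtain ⟨n, rfl⟩ : ∃ n, l = n + 1 := ⟨l - 1, by omega⟩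
      rw [← epow, sub_eq_zero, pow_succ, ← mul_assoc] at e
      rw [Nat.add_sub_cancel, sub_eq_zero]
      calc q ^ 2 = 1 * q ^ 2 := (one_mul _).symm
        _ = _ := by rw [e, mul_assoc, inv_mul_cancel₀ hQ, mul_one]
    -- the rightmost row turns `f` into an element to which the induction hypothesis applies
    have hrow : ∀ i, o + 1 ≤ i → i + 1 < o + 1 + k + l → i + 1 ≠ o + 1 + l →
        t i * (rRow (q ^ 2) t o l z * f) = rRow (q ^ 2) t o l z * f := by
      intro i h1 h2 h3
      rcases lt_or_ge (o + l) i with hi | hi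
      · have hc : Commute (t i) (rRow (q ^ 2) t o l z) :=
          Commute.rRow fun j h4 h5 => h.commute (by omega) (by omega) (by omega)
        rw [← mul_assoc, hc.eq, mul_assoc, hf i (by omega) (by omega) (by omega)]
      · obtain ⟨m, rfl⟩ : ∃ m, l = m + 1 := ⟨l - 1, by omega⟩
        obtain ⟨i, rfl⟩ : ∃ i', i = i' + 1 := ⟨i - 1, by omega⟩
        have hfix : ∀ j, o ≤ j → j < o + m → t j * f = f :=
          fun j h4 h5 => hf j h4 (by omega) (by omega)
        have key := h.rRow_mul hQ (f := f) (a := o) (m := m) (u := z) (by omega) hz0 hfix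
        rw [epow] at key
        have e1 : t (i + 1) * (ascProd t o (m + 1) * f) = ascProd t o (m + 1) * f := by
          rw [← mul_assoc, ← h.ascProd_mul (by omega) (by omega) (by omega), mul_assoc,
            hfix i (by omega) (by omega)]
        have e2 : t (i + 1) * cosetSum (q ^ 2) t f (o + 1) m = cosetSum (q ^ 2) t f (o + 1) m :=
          h.mul_cosetSum (by omega) (fun j h4 h5 => hfix j (by omega) (by omega)) (by omega)
            (by omega)
        have := congrArg (fun x => t (i + 1) * x) key
        simp only [mul_smul_comm, mul_add, e1, e2] at this
        rw [← key] at this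
        exact smul_right_injective A hne this
    have ih' := ih (f := rRow (q ^ 2) t o l z * f) (o := o + 1) (z := z * q ^ 2) (by omega)
      (by omega)
      (fun a ha j hj => by
        have := hz (a + 1) (by omega) j hj
        rwa [pow_succ' (q ^ 2), ← mul_assoc] at this)
      (fun i h1 h2 h3 => hψ i (by omega) (by omega) (by omega)) hrow
    rw [rRows, ← mul_assoc, mul_assoc, ih']
    apply smul_right_injective A hne
    simp only [Finset.smul_sum, smul_smul]
    set B : ℕ → A := fun p => ψ * crossing t (o + (k + 1) - p) p (l - (k + 1) + p) * f with hB
    have step : ∀ p ∈ Finset.range (k + 1), ((1 - z * q ^ (-2 * (l : ℤ))) *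
        aCoeff q k l p (z * q ^ 2)) •
          (ψ * crossing t (o + 1 + k - p) p (l - k + p) * (rRow (q ^ 2) t o l z * f)) =
        ((1 - q ^ (-2 * ((l : ℤ) - k + p))) * aCoeff q k l p (z * q ^ 2)) • B p +
        ((q ^ (-2 * ((l : ℤ) - k + p)) - z * q ^ (-2 * (l : ℤ))) *
          aCoeff q k l p (z * q ^ 2)) • B (p + 1) := by
      intro p hp
      have hp' : p ≤ k := by have := Finset.mem_range.mp hp; omega
      have := h.mul_crossing_mul_rRow hQ (ψ := ψ) (f := f) (o := o) (z := z) hkl hp' (by omega) hz0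
        (fun i h1 h2 h3 => hψ i h1 (by omega) (by omega))
        (fun i h1 h2 h3 => hf i h1 (by omega) (by omega))
      rw [epow, epow, show (((l - k + p : ℕ) : ℤ)) = (l : ℤ) - k + p by omega] at this
      rw [mul_comm, mul_smul, this, smul_add, smul_smul, smul_smul, mul_comm,
        mul_comm (aCoeff _ _ _ _ _)]
    rw [Finset.sum_congr rfl step, Finset.sum_add_distrib]
    rw [Finset.sum_range_succ' _ (k + 1), Finset.sum_range_succ' _ k]
    have hlast : aCoeff q k l (k + 1) (z * q ^ 2) = 0 := by
      rw [aCoeff, qBinom_of_lt _ (by push_cast; omega)]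
      simp
    have hs : ∑ p ∈ Finset.range k, ((1 - q ^ (-2 * ((l : ℤ) - k + (p + 1 : ℕ)))) *
          aCoeff q k l (p + 1) (z * q ^ 2)) • B (p + 1) =
        ∑ p ∈ Finset.range (k + 1), ((1 - q ^ (-2 * ((l : ℤ) - k + (p + 1 : ℕ)))) *
          aCoeff q k l (p + 1) (z * q ^ 2)) • B (p + 1) := by
      rw [Finset.sum_range_succ, hlast, mul_zero, zero_smul, add_zero]
    rw [hs, add_right_comm, ← Finset.sum_add_distrib, aCoeff_succ_zero hq0 hq hkl hne]
    congr 1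
    · refine Finset.sum_congr rfl fun p hp => ?_
      have hp' : p ≤ k := by have := Finset.mem_range.mp hp; omega
      rw [← add_smul, aCoeff_succ_succ hq0 hq hkl hp' hne]
      push_cast
      rfl
    · simp [hB]

end Fusion

/-! ### Counting letters in words -/

/-- A word extended by the letter `0` to an infinite word; positions start at `0`. -/
def extWord {n : ℕ} (w : TWord n) (s : ℕ) : Fin 2 := if h : s < n then w ⟨s, h⟩ else 0

/-- The number of letters `0`, that is of tensor factors `e_1`, at the positions
`a, …, b - 1`. -/
def zeroCount (u : ℕ → Fin 2) (a b : ℕ) : ℕ := ∑ s ∈ Finset.Ico a b, if u s = 0 then 1 else 0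

/-- The sum of the positions of the letters `0` among the positions `a, …, b - 1`. Up to a
constant it counts inversions, but it is additive in the interval. -/
def zeroSum (u : ℕ → Fin 2) (a b : ℕ) : ℕ := ∑ s ∈ Finset.Ico a b, if u s = 0 then s else 0

theorem extWord_of_lt {n : ℕ} (w : TWord n) {s : ℕ} (h : s < n) : extWord w s = w ⟨s, h⟩ :=
  dif_pos h

theorem extWord_injective {n : ℕ} {w v : TWord n} (h : ∀ s < n, extWord w s = extWord v s) :
    w = v := by
  funext ⟨s, hs⟩
  simpa [extWord, hs] using h s hs

theorem extWord_swapWord {n : ℕ} (i : HeckeIndex n) (w : TWord n) :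
    extWord (swapWord i w) = extWord w ∘ Equiv.swap (i.1 - 1) i.1 := by
  have hi := i.2
  have hn : i.1 - 1 < n := by omega
  funext s
  rw [Function.comp_apply]
  by_cases h1 : s = i.1 - 1
  · subst h1
    rw [Equiv.swap_apply_left, extWord_of_lt _ hn, extWord_of_lt _ hi.2, swapWord_left]
  by_cases h2 : s = i.1
  · subst h2
    rw [Equiv.swap_apply_right, extWord_of_lt _ hn, extWord_of_lt _ hi.2, swapWord_right]
  rw [Equiv.swap_apply_of_ne_of_ne h1 h2]
  by_cases h : s < n
  · rw [extWord_of_lt _ h, extWord_of_lt _ h, swapWord_other i w ⟨s, h⟩ h1 h2]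
  · simp [extWord, h]

theorem zeroCount_add (u : ℕ → Fin 2) {a b c : ℕ} (h1 : a ≤ b) (h2 : b ≤ c) :
    zeroCount u a b + zeroCount u b c = zeroCount u a c :=
  Finset.sum_Ico_consecutive _ h1 h2

theorem zeroSum_add (u : ℕ → Fin 2) {a b c : ℕ} (h1 : a ≤ b) (h2 : b ≤ c) :
    zeroSum u a b + zeroSum u b c = zeroSum u a c :=
  Finset.sum_Ico_consecutive _ h1 h2

theorem zeroCount_self (u : ℕ → Fin 2) (a : ℕ) : zeroCount u a a = 0 := by simp [zeroCount]

theorem zeroCount_succ_left (u : ℕ → Fin 2) {a b : ℕ} (h : a < b) :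
    zeroCount u a b = (if u a = 0 then 1 else 0) + zeroCount u (a + 1) b :=
  Finset.sum_eq_sum_Ico_succ_bot h _

theorem zeroCount_succ_right (u : ℕ → Fin 2) {a b : ℕ} (h : a ≤ b) :
    zeroCount u a (b + 1) = zeroCount u a b + (if u b = 0 then 1 else 0) :=
  Finset.sum_Ico_succ_top h _

theorem zeroCount_le (u : ℕ → Fin 2) (a b : ℕ) : zeroCount u a b ≤ b - a := by
  calc zeroCount u a b ≤ ∑ s ∈ Finset.Ico a b, 1 :=
        Finset.sum_le_sum fun s _ => by split_ifs <;> omega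
    _ = b - a := by simp

theorem zeroCount_congr {u v : ℕ → Fin 2} {a b : ℕ} (h : ∀ s, a ≤ s → s < b → u s = v s) :
    zeroCount u a b = zeroCount v a b :=
  Finset.sum_congr rfl fun s hs => by
    rw [h s (Finset.mem_Ico.mp hs).1 (Finset.mem_Ico.mp hs).2]

theorem zeroSum_congr {u v : ℕ → Fin 2} {a b : ℕ} (h : ∀ s, a ≤ s → s < b → u s = v s) :
    zeroSum u a b = zeroSum v a b :=
  Finset.sum_congr rfl fun s hs => by
    rw [h s (Finset.mem_Ico.mp hs).1 (Finset.mem_Ico.mp hs).2]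

/-- A swap of neighbouring positions inside the interval of summation. -/
theorem sum_Ico_comp_swap (F : ℕ → Fin 2 → ℕ) (u : ℕ → Fin 2) {a b i : ℕ} (h1 : a ≤ i)
    (h2 : i + 1 < b) :
    ∑ s ∈ Finset.Ico a b, F s ((u ∘ Equiv.swap i (i + 1)) s) + F i (u i) + F (i + 1) (u (i + 1)) =
      ∑ s ∈ Finset.Ico a b, F s (u s) + F i (u (i + 1)) + F (i + 1) (u i) := by
  have e : ∀ G : ℕ → ℕ, ∑ s ∈ Finset.Ico a b, G s =
      ∑ s ∈ Finset.Ico a i, G s + (G i + (G (i + 1) + ∑ s ∈ Finset.Ico (i + 2) b, G s)) := by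
    intro G
    rw [← Finset.sum_Ico_consecutive G h1 (by omega : i ≤ b),
      Finset.sum_eq_sum_Ico_succ_bot (by omega : i < b),
      Finset.sum_eq_sum_Ico_succ_bot (by omega : i + 1 < b)]
  rw [e, e]
  have e1 : ∑ s ∈ Finset.Ico a i, F s ((u ∘ Equiv.swap i (i + 1)) s) =
      ∑ s ∈ Finset.Ico a i, F s (u s) := by
    refine Finset.sum_congr rfl fun s hs => ?_
    have := Finset.mem_Ico.mp hs
    rw [Function.comp_apply, Equiv.swap_apply_of_ne_of_ne (by omega) (by omega)]
  have e2 : ∑ s ∈ Finset.Ico (i + 2) b, F s ((u ∘ Equiv.swap i (i + 1)) s) =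
      ∑ s ∈ Finset.Ico (i + 2) b, F s (u s) := by
    refine Finset.sum_congr rfl fun s hs => ?_
    have := Finset.mem_Ico.mp hs
    rw [Function.comp_apply, Equiv.swap_apply_of_ne_of_ne (by omega) (by omega)]
  rw [e1, e2]
  simp only [Function.comp_apply, Equiv.swap_apply_left, Equiv.swap_apply_right]
  ring

theorem zeroCount_comp_swap (u : ℕ → Fin 2) {a b i : ℕ}
    (h : i + 1 < a ∨ (a ≤ i ∧ i + 1 < b) ∨ b ≤ i) :
    zeroCount (u ∘ Equiv.swap i (i + 1)) a b = zeroCount u a b := by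
  by_cases h' : a ≤ i ∧ i + 1 < b
  · have := sum_Ico_comp_swap (fun _ x => if x = 0 then 1 else 0) u h'.1 h'.2
    simp only [zeroCount]
    omega
  · refine zeroCount_congr fun s h1 h2 => ?_
    rw [Function.comp_apply, Equiv.swap_apply_of_ne_of_ne (by omega) (by omega)]

/-- Exchanging a letter `0` with a following letter `1` raises the sum of positions by one. -/
theorem zeroSum_comp_swap (u : ℕ → Fin 2) {a b i : ℕ} (h1 : a ≤ i) (h2 : i + 1 < b)
    (h3 : u i = 0) (h4 : u (i + 1) = 1) :
    zeroSum (u ∘ Equiv.swap i (i + 1)) a b = zeroSum u a b + 1 := by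
  have := sum_Ico_comp_swap (fun s x => if x = 0 then s else 0) u h1 h2
  simp only [h3, h4, if_true, one_ne_zero, if_false] at this
  simp only [zeroSum]
  omega

/-- A word without descents consists of letters `0` followed by letters `1`. -/
theorem eq_of_no_descent {u : ℕ → Fin 2} {a b : ℕ}
    (h : ∀ s, a ≤ s → s + 1 < b → ¬ (u s = 1 ∧ u (s + 1) = 0)) {s : ℕ} (h1 : a ≤ s) (h2 : s < b) :
    u s = if s < a + zeroCount u a b then 0 else 1 := by
  induction b generalizing s with
  | zero => omega
  | succ b ih =>
    have ih' := fun s h1 h2 => @ih (fun s h1 h2 => h s h1 (by omega)) s h1 h2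
    have hle := zeroCount_le u a b
    rw [zeroCount_succ_right u (by omega)]
    have h01 : ∀ x : Fin 2, x = 0 ∨ x = 1 := by decide
    rcases h01 (u b) with hb | hb
    · have hfull : zeroCount u a b = b - a := by
        by_contra hne
        obtain ⟨c, rfl⟩ : ∃ c, b = c + 1 := ⟨b - 1, by omega⟩
        have := ih' c (by omega) (by omega)
        rw [if_neg (by omega)] at this
        exact h c (by omega) (by omega) ⟨this, hb⟩
      rw [hb, if_pos rfl, if_pos (by omega)]
      rcases (Nat.lt_succ_iff.mp h2).eq_or_lt with rfl | h3
      · exact hb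
      · rw [ih' s h1 h3, if_pos (by omega)]
    · rw [hb, if_neg (show ¬ (1 : Fin 2) = 0 by decide), add_zero]
      rcases (Nat.lt_succ_iff.mp h2).eq_or_lt with rfl | h3
      · rw [hb, if_neg (by omega)]
      · exact ih' s h1 h3

/-! ### Functions on words that are determined by block contents -/

theorem zeroCount_blockWord_left {n a i j : ℕ} (ha : a ≤ n) (hi : i ≤ a) :
    zeroCount (extWord (blockWord n a i j)) 0 a = i := by
  have : ∀ s, s < a → extWord (blockWord n a i j) s = if s < i then 0 else 1 := by
    intro s hs
    rw [extWord_of_lt _ (by omega)]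
    simp [blockWord, hs]
  have e : zeroCount (extWord (blockWord n a i j)) 0 a =
      ∑ s ∈ Finset.range a, if s < i then 1 else 0 := by
    rw [zeroCount, Finset.range_eq_Ico]
    refine Finset.sum_congr rfl fun s hs => ?_
    rw [this s (Finset.mem_Ico.mp hs).2]
    split_ifs <;> simp_all
  rw [e, Finset.sum_boole]
  simp only [Nat.cast_id]
  rw [show Finset.filter (fun s => s < i) (Finset.range a) = Finset.range i by
    ext s; simp; omega, Finset.card_range]

theorem zeroCount_blockWord_right {n a i j : ℕ} (hj : a + j ≤ n) :
    zeroCount (extWord (blockWord n a i j)) a n = j := by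
  have : ∀ s, a ≤ s → s < n → extWord (blockWord n a i j) s = if s < a + j then 0 else 1 := by
    intro s h1 h2
    rw [extWord_of_lt _ h2]
    simp [blockWord, not_lt.mpr h1]
  have e : zeroCount (extWord (blockWord n a i j)) a n =
      ∑ s ∈ Finset.Ico a n, if s < a + j then 1 else 0 := by
    refine Finset.sum_congr rfl fun s hs => ?_
    rw [this s (Finset.mem_Ico.mp hs).1 (Finset.mem_Ico.mp hs).2]
    split_ifs <;> simp_all
  rw [e, Finset.sum_boole]
  simp only [Nat.cast_id]
  rw [show Finset.filter (fun s => s < a + j) (Finset.Ico a n) = Finset.Ico a (a + j) by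
    ext s; simp; omega, Nat.card_Ico]
  omega

theorem eq_blockWord {n a : ℕ} (w : TWord n) (ha : a ≤ n)
    (h : ∀ s, s + 1 < n → s + 1 ≠ a → ¬ (extWord w s = 1 ∧ extWord w (s + 1) = 0)) :
    w = blockWord n a (zeroCount (extWord w) 0 a) (zeroCount (extWord w) a n) := by
  apply extWord_injective
  intro s hs
  rw [extWord_of_lt (blockWord n a _ _) hs]
  by_cases hsa : s < a
  · have := eq_of_no_descent (u := extWord w) (a := 0) (b := a)
      (fun s h1 h2 => h s (by omega) (by omega)) (Nat.zero_le s) hsa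
    simpa [blockWord, hsa] using this
  · have := eq_of_no_descent (u := extWord w) (a := a) (b := n)
      (fun s h1 h2 => h s (by omega) (by omega)) (not_lt.mp hsa) hs
    simpa [blockWord, hsa] using this

/-- A function on words that is multiplied by `c` whenever letters `0, 1` at neighbouring
positions of the same block are exchanged is determined by its values on sorted words. -/
theorem eq_blockWord_of_swap {n a : ℕ} (ha : a ≤ n) {c : ℂ} {g : TWord n → ℂ}
    (h : ∀ (i : HeckeIndex n) (w : TWord n), i.1 ≠ a → extWord w (i.1 - 1) = 0 →
      extWord w i.1 = 1 → g (swapWord i w) = c * g w) (w : TWord n) :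
    c ^ zeroSum (extWord (blockWord n a (zeroCount (extWord w) 0 a)
        (zeroCount (extWord w) a n))) 0 n * g w =
      c ^ zeroSum (extWord w) 0 n *
        g (blockWord n a (zeroCount (extWord w) 0 a) (zeroCount (extWord w) a n)) := by
  induction hm : zeroSum (extWord w) 0 n using Nat.strong_induction_on generalizing w with
  | _ m ih =>
    by_cases hd : ∀ s, s + 1 < n → s + 1 ≠ a → ¬ (extWord w s = 1 ∧ extWord w (s + 1) = 0)
    · have := eq_blockWord w ha hd
      rw [← this, hm]
    · push Not at hd
      obtain ⟨s, h1, h2, h3, h4⟩ := hd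
      -- undoing the descent at `s` lowers the sum of positions
      let i : HeckeIndex n := ⟨s + 1, by omega, h1⟩
      have hv : extWord (swapWord i w) = extWord w ∘ Equiv.swap s (s + 1) := extWord_swapWord i w
      have hv0 : extWord (swapWord i w) s = 0 := by
        rw [hv, Function.comp_apply, Equiv.swap_apply_left, h4]
      have hv1 : extWord (swapWord i w) (s + 1) = 1 := by
        rw [hv, Function.comp_apply, Equiv.swap_apply_right, h3]
      have hw : extWord w = extWord (swapWord i w) ∘ Equiv.swap s (s + 1) := by
        rw [hv, Function.comp_assoc, ← Equiv.coe_trans, Equiv.swap_swap]; rfl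
      have hsum : zeroSum (extWord w) 0 n = zeroSum (extWord (swapWord i w)) 0 n + 1 := by
        conv_lhs => rw [hw]
        exact zeroSum_comp_swap _ (Nat.zero_le s) h1 hv0 hv1
      have hc1 : zeroCount (extWord (swapWord i w)) 0 a = zeroCount (extWord w) 0 a := by
        rw [hv]; exact zeroCount_comp_swap _ (by omega)
      have hc2 : zeroCount (extWord (swapWord i w)) a n = zeroCount (extWord w) a n := by
        rw [hv]; exact zeroCount_comp_swap _ (by omega)
      have := ih _ (by omega) (swapWord i w) rfl
      rw [hc1, hc2] at this
      have hg := h i (swapWord i w) h2 hv0 hv1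
      rw [swapWord_swapWord] at hg
      rw [hg, ← hm, hsum, pow_succ, mul_left_comm, this]
      ring

/-! ### Sums over words -/

/-- The sum over all words of length `n` of a function of infinite words. -/
noncomputable def wordSum (n : ℕ) (Φ : (ℕ → Fin 2) → ℂ) : ℂ := ∑ w : TWord n, Φ (extWord w)

theorem wordSum_zero (Φ : (ℕ → Fin 2) → ℂ) : wordSum 0 Φ = Φ fun _ => 0 := by
  simp only [wordSum, Finset.univ_unique, Finset.sum_singleton]
  congr 1

theorem wordSum_succ (n : ℕ) (Φ : (ℕ → Fin 2) → ℂ) :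
    wordSum (n + 1) Φ =
      ∑ w : TWord n, (Φ (extWord w) + Φ (Function.update (extWord w) n 1)) := by
  rw [wordSum, ← (Fin.snocEquiv fun _ : Fin (n + 1) => Fin 2).sum_comp, Fintype.sum_prod_type_right]
  refine Finset.sum_congr rfl fun w _ => ?_
  rw [Fin.sum_univ_two]
  have e : ∀ x : Fin 2, extWord (Fin.snoc (α := fun _ => Fin 2) w x) =
      Function.update (extWord w) n x := by
    intro x
    funext s
    rcases lt_trichotomy s n with h | rfl | h
    · rw [Function.update_of_ne h.ne, extWord_of_lt _ (by omega), extWord_of_lt _ h]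
      exact Fin.snoc_castSucc (α := fun _ => Fin 2) x w ⟨s, h⟩
    · rw [Function.update_self, extWord_of_lt _ (by omega)]
      exact Fin.snoc_last (α := fun _ => Fin 2) x w
    · rw [Function.update_of_ne h.ne']
      simp [extWord, not_lt.mpr h.le, not_lt.mpr (Nat.succ_le_iff.mpr h)]
  have e0 : Function.update (extWord w) n 0 = extWord w := by
    rw [Function.update_eq_self_iff]
    simp [extWord]
  congr 1
  · exact congrArg Φ ((e 0).trans e0)
  · exact congrArg Φ (e 1)

/-- The weight of the block at the positions `a, …, b - 1`: the power of `q ^ 2` given by the sum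
of the positions of the letters `0`, if there are `d` of them. -/
noncomputable def blockWeight (q : ℂ) (d a b : ℕ) (u : ℕ → Fin 2) : ℂ :=
  if zeroCount u a b = d then (q ^ 2) ^ zeroSum u a b else 0

theorem blockWeight_congr {q : ℂ} {d a b : ℕ} {u v : ℕ → Fin 2}
    (h : ∀ s, a ≤ s → s < b → u s = v s) : blockWeight q d a b u = blockWeight q d a b v := by
  rw [blockWeight, blockWeight, zeroCount_congr h, zeroSum_congr h]

theorem zeroSum_succ_right (u : ℕ → Fin 2) {a b : ℕ} (h : a ≤ b) :
    zeroSum u a (b + 1) = zeroSum u a b + (if u b = 0 then b else 0) :=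
  Finset.sum_Ico_succ_top h _

/-- The sum `0 + 1 + ⋯ + (d - 1)`. -/
def triangle (d : ℕ) : ℕ := ∑ s ∈ Finset.range d, s

theorem triangle_add (c d : ℕ) : triangle (c + d) = triangle c + triangle d + c * d := by
  rw [triangle, Finset.sum_range_add, Finset.sum_add_distrib]
  simp [triangle]
  ring

theorem triangle_succ (d : ℕ) : triangle (d + 1) = triangle d + d := Finset.sum_range_succ _ _

/-- Summing over the letters of the last block produces a `q`-binomial coefficient. -/
theorem wordSum_mul_blockWeight {q : ℂ} {l : ℕ}
    (hq : ∀ n : ℕ, 1 ≤ n → n ≤ l → q ^ (2 * n) ≠ 1)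
    {n a b : ℕ} (hn : n = a + b) (hb : b ≤ l) (d : ℕ) {Ψ : (ℕ → Fin 2) → ℂ}
    (hΨ : ∀ u v : ℕ → Fin 2, (∀ s < a, u s = v s) → Ψ u = Ψ v) :
    wordSum n (fun u => Ψ u * blockWeight q d a n u) =
      (q ^ 2) ^ (a * d + triangle d) * qBinom q b d * wordSum a Ψ := by
  subst hn
  induction b generalizing d with
  | zero =>
    simp only [Nat.add_zero, blockWeight, zeroCount_self]
    rcases Nat.eq_zero_or_pos d with rfl | hd
    · simp [zeroSum, triangle, qBinom, qFact, wordSum]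
    · rw [qBinom_of_lt _ (by omega)]
      simp [hd.ne, wordSum]
  | succ b ih =>
    have ih' := fun d => ih (by omega) d
    rw [← add_assoc, wordSum_succ]
    -- a last letter `1` contributes nothing
    have h1 : ∀ w : TWord (a + b),
        Ψ (Function.update (extWord w) (a + b) 1) *
          blockWeight q d a (a + b + 1) (Function.update (extWord w) (a + b) 1) =
        Ψ (extWord w) * blockWeight q d a (a + b) (extWord w) := by
      intro w
      have hu : ∀ s, s < a + b → Function.update (extWord w) (a + b) 1 s = extWord w s :=
        fun s hs => Function.update_of_ne hs.ne _ _
      rw [hΨ _ (extWord w) fun s hs => hu s (by omega), blockWeight, blockWeight,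
        zeroCount_succ_right _ (by omega), zeroSum_succ_right _ (by omega), Function.update_self,
        zeroCount_congr fun s _ hs => hu s hs, zeroSum_congr fun s _ hs => hu s hs]
      simp
    have h0 : ∀ w : TWord (a + b), extWord w (a + b) = 0 := fun w => by simp [extWord]
    simp only [h1, Finset.sum_add_distrib]
    change _ + wordSum (a + b) (fun u => Ψ u * blockWeight q d a (a + b) u) = _
    rw [ih' d]
    push_cast
    rw [qBinom_succ hq (by omega)]
    cases d with
    | zero =>
      rw [qBinom_of_neg q b (show ((0 : ℕ) : ℤ) - 1 < 0 by omega), Finset.sum_eq_zero]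
      · ring
      · intro w _
        rw [blockWeight, zeroCount_succ_right _ (by omega), h0]
        simp
    | succ d =>
      -- a last letter `0` stands at position `a + b`
      have h2 : ∀ w : TWord (a + b),
          Ψ (extWord w) * blockWeight q (d + 1) a (a + b + 1) (extWord w) =
          (q ^ 2) ^ (a + b) * (Ψ (extWord w) * blockWeight q d a (a + b) (extWord w)) := by
        intro w
        rw [blockWeight, blockWeight, zeroCount_succ_right _ (by omega),
          zeroSum_succ_right _ (by omega), h0]
        simp only [if_true, Nat.add_right_cancel_iff]
        split_ifs
        · rw [pow_add]; ring
        · simp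
      simp only [h2, ← Finset.mul_sum]
      change (q ^ 2) ^ (a + b) *
        wordSum (a + b) (fun u => Ψ u * blockWeight q d a (a + b) u) + _ = _
      rw [ih' d]
      push_cast
      rw [add_sub_cancel_right]
      rcases lt_or_ge b d with hbd | hbd
      · rw [qBinom_of_lt q (show (b : ℤ) < d by omega)]
        ring
      have e : (q ^ 2) ^ (a + b) * (q ^ 2) ^ (a * d + triangle d) =
          (q ^ 2) ^ (a * (d + 1) + triangle (d + 1)) * q ^ (2 * ((b : ℤ) + 1 - (d + 1))) := by
        obtain ⟨c, rfl⟩ := Nat.exists_eq_add_of_le hbd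
        have : q ^ (2 * (((d + c : ℕ) : ℤ) + 1 - (d + 1))) = (q ^ 2) ^ c := by
          rw [← pow_mul, ← zpow_natCast]; congr 1; push_cast; ring
        rw [this, ← pow_add, ← pow_add, triangle_succ]
        congr 1; ring
      linear_combination (qBinom q b d * wordSum a Ψ) * e

theorem wordSum_two_blocks {q : ℂ} {l : ℕ}
    (hq : ∀ n : ℕ, 1 ≤ n → n ≤ l → q ^ (2 * n) ≠ 1) {n a b : ℕ} (hn : n = a + b) (ha : a ≤ l)
    (hb : b ≤ l) (i j : ℕ) :
    wordSum n (fun u => blockWeight q i 0 a u * blockWeight q j a n u) =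
      (q ^ 2) ^ (triangle i + (a * j + triangle j)) * (qBinom q a i * qBinom q b j) := by
  rw [wordSum_mul_blockWeight hq hn hb j fun u v h => blockWeight_congr fun s _ hs => h s hs]
  have := wordSum_mul_blockWeight hq (zero_add a).symm ha i (Ψ := fun _ => 1) fun _ _ _ => rfl
  simp only [one_mul, wordSum_zero, mul_one, zero_mul, zero_add] at this
  rw [this, pow_add]
  ring

theorem wordSum_four_blocks {q : ℂ} {l : ℕ}
    (hq : ∀ n : ℕ, 1 ≤ n → n ≤ l → q ^ (2 * n) ≠ 1) {n a b c d x y : ℕ} (hx : x = a + b)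
    (hy : y = x + c) (hn : n = y + d) (ha : a ≤ l) (hb : b ≤ l) (hc : c ≤ l) (hd : d ≤ l)
    (i r s j : ℕ) :
    wordSum n (fun u => blockWeight q i 0 a u * blockWeight q r a x u * blockWeight q s x y u *
        blockWeight q j y n u) =
      (q ^ 2) ^ (triangle i + (a * r + triangle r) + (x * s + triangle s) +
        (y * j + triangle j)) *
      (qBinom q a i * qBinom q b r * qBinom q c s * qBinom q d j) := by
  rw [wordSum_mul_blockWeight hq hn hd j fun u v h => ?_,
    wordSum_mul_blockWeight hq hy hc s fun u v h => ?_, wordSum_two_blocks hq hx ha hb]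
  · simp only [pow_add]
    ring
  · rw [blockWeight_congr fun s _ hs => h s (by omega), blockWeight_congr fun s _ hs => h s hs]
  · rw [blockWeight_congr fun s _ hs => h s (by omega),
      blockWeight_congr (a := a) fun s _ hs => h s (by omega),
      blockWeight_congr (a := x) fun s _ hs => h s hs]

/-! ### The symmetrisers in the stochastic representation -/

/-- The generators in the stochastic representation, with indices starting at `0`. -/
noncomputable def sigmaFamily (q : ℂ) (n i : ℕ) : Matrix (TWord n) (TWord n) ℂ :=
  heckeRep q n (heckeSigma q n (i + 1))

theorem sigmaFamily_of_lt (q : ℂ) {n i : ℕ} (h : i + 1 < n) :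
    sigmaFamily q n i = sigmaMatrix q ⟨i + 1, by omega, h⟩ :=
  heckeRep_sigma q n ⟨i + 1, by omega, h⟩

theorem isHeckeFamily_sigmaFamily (q : ℂ) (n : ℕ) :
    IsHeckeFamily (q ^ 2) (n - 1) (sigmaFamily q n) where
  quad i hi := by
    rw [sigmaFamily_of_lt q (by omega)]
    exact sigmaMatrix_quad q _
  braid i hi := by
    rw [sigmaFamily_of_lt q (by omega), sigmaFamily_of_lt q (by omega)]
    exact sigmaMatrix_braid q _ _ rfl
  comm i j hij hj := by
    rw [sigmaFamily_of_lt q (by omega), sigmaFamily_of_lt q (by omega)]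
    exact sigmaMatrix_comm q _ _ (by simpa using hij)

theorem heckeRep_heckeR (q : ℂ) (n i : ℕ) (u : ℂ) :
    heckeRep q n (heckeR q n (i + 1) u) = rElt (q ^ 2) (sigmaFamily q n) i u := by
  simp [heckeR, rElt, sigmaFamily]

theorem rRowRev_eq_prod (q : ℂ) (hq0 : q ≠ 0) (n o m : ℕ) (c : ℤ) :
    rRowRev (q ^ 2) (sigmaFamily q n) o m (q ^ (-2 * c)) =
      ((List.range m).map fun t =>
        heckeRep q n (heckeR q n (o + m - t) (q ^ (-2 * ((m : ℤ) - 1 - t + c))))).prod := by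
  induction m generalizing o c with
  | zero => simp [rRowRev]
  | succ m ih =>
    have e : q ^ (-2 * c) * (q ^ 2)⁻¹ = q ^ (-2 * (c + 1)) := by
      rw [mul_add, zpow_add₀ hq0]
      rfl
    rw [rRowRev, e, ih, List.range_succ, List.map_append, List.prod_append]
    congr 1
    · congr 1
      refine List.map_congr_left fun t _ => ?_
      congr 2
      · omega
      · congr 1; push_cast; ring
    · rw [List.map_singleton, List.prod_singleton, ← heckeRep_heckeR,
        show o + (m + 1) - m = o + 1 by omega]
      congr 3; push_cast; ring

theorem heckeRep_heckeS (q : ℂ) (hq0 : q ≠ 0) (n o m : ℕ) :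
    heckeRep q n (heckeS q n (o + 1) (o + 1 + m)) =
      symR (q ^ 2) (sigmaFamily q n) o m := by
  rw [heckeS, Nat.add_sub_cancel_left]
  induction m with
  | zero => simp [symR]
  | succ m ih =>
    rw [List.range_succ, List.map_append, List.prod_append, map_mul, ih, symR]
    congr 1
    have e : (q ^ 2)⁻¹ = q ^ (-2 * (1 : ℤ)) := rfl
    rw [e, rRowRev_eq_prod q hq0, List.map_singleton, List.prod_singleton, map_list_prod,
      List.map_map]
    congr 1
    refine List.map_congr_left fun t _ => ?_
    rw [Function.comp_apply]
    congr 2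
    · omega
    · congr 1; push_cast; ring

theorem projMatrix_eq (q : ℂ) (hq0 : q ≠ 0) {n a b : ℕ} (ha : 1 ≤ a) (hb : 1 ≤ b) :
    projMatrix q n a b = symR (q ^ 2) (sigmaFamily q n) 0 (a - 1) *
      symR (q ^ 2) (sigmaFamily q n) a (b - 1) := by
  obtain ⟨a, rfl⟩ : ∃ a', a = a' + 1 := ⟨a - 1, by omega⟩
  obtain ⟨b, rfl⟩ : ∃ b', b = b' + 1 := ⟨b - 1, by omega⟩
  have h1 := heckeRep_heckeS q hq0 n 0 a
  have h2 := heckeRep_heckeS q hq0 n (a + 1) b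
  rw [zero_add, show 1 + a = a + 1 by omega] at h1
  rw [show a + 1 + 1 + b = a + 1 + (b + 1) by omega] at h2
  rw [Nat.add_sub_cancel, Nat.add_sub_cancel, ← h1, ← h2, projMatrix, heckeP, map_mul]

theorem rRow_eq_prod (q : ℂ) (n a m : ℕ) (u : ℂ) :
    rRow (q ^ 2) (sigmaFamily q n) a m u =
      ((List.range m).map fun j =>
        rElt (q ^ 2) (sigmaFamily q n) (a + j) (u * (q ^ 2)⁻¹ ^ j)).prod := by
  induction m generalizing a u with
  | zero => rfl
  | succ m ih =>
    rw [rRow, ih, List.range_succ_eq_map, List.map_cons, List.prod_cons, List.map_map]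
    congr 1
    · simp
    · congr 1
      refine List.map_congr_left fun j _ => ?_
      rw [Function.comp_apply, pow_succ' (q ^ 2)⁻¹, mul_assoc]
      congr 1; omega

theorem rRows_eq_prod (q : ℂ) (n l o k : ℕ) (z : ℂ) :
    rRows (q ^ 2) (sigmaFamily q n) l o k z =
      ((List.range k).reverse.map fun a =>
        rRow (q ^ 2) (sigmaFamily q n) (o + a) l (z * (q ^ 2) ^ a)).prod := by
  induction k generalizing o z with
  | zero => rfl
  | succ k ih =>
    rw [rRows, ih, List.range_succ_eq_map, List.reverse_cons, List.map_append, List.prod_append,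
      ← List.map_reverse, List.map_map]
    congr 1
    · congr 1
      refine List.map_congr_left fun j _ => ?_
      rw [Function.comp_apply, pow_succ' (q ^ 2), mul_assoc]
      congr 1; omega
    · simp

theorem fusedRMatrix_eq (q : ℂ) (hq0 : q ≠ 0) (k l : ℕ) (z : ℂ) :
    fusedRMatrix q k l z = projMatrix q (k + l) k l *
      rRows (q ^ 2) (sigmaFamily q (k + l)) l 0 k z * projMatrix q (k + l) l k := by
  rw [fusedRMatrix, fusedR, map_mul, map_mul, ← projMatrix, ← projMatrix, rRows_eq_prod,
    map_list_prod, List.map_map]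
  congr 3
  refine List.map_congr_left fun a _ => ?_
  rw [Function.comp_apply, map_list_prod, List.map_map, rRow_eq_prod]
  congr 1
  refine List.map_congr_left fun j _ => ?_
  rw [Function.comp_apply, ← heckeRep_heckeR]
  congr 2
  · omega
  · have e : q ^ (-2 * ((j : ℤ) - a)) = (q ^ 2) ^ a * (q ^ 2)⁻¹ ^ j := by
      rw [inv_pow, ← pow_mul, ← pow_mul, ← zpow_natCast, ← zpow_natCast, ← zpow_neg,
        ← zpow_add₀ hq0]
      congr 1; push_cast; ring
    rw [e, mul_assoc]

section Projection

variable {q : ℂ} {l n a b : ℕ}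

theorem pow_two_pow_ne_one (hq : ∀ n : ℕ, 1 ≤ n → n ≤ l → q ^ (2 * n) ≠ 1) {m : ℕ}
    (hm : m + 1 ≤ l) : ∀ j ≤ m, (q ^ 2) ^ (j + 1) ≠ 1 := fun j hj => by
  rw [← pow_mul]
  exact hq (j + 1) (by omega) (by omega)

theorem sigmaFamily_mul_projMatrix (hq0 : q ≠ 0)
    (hq : ∀ n : ℕ, 1 ≤ n → n ≤ l → q ^ (2 * n) ≠ 1) (hn : n = a + b) (ha : 1 ≤ a) (hb : 1 ≤ b)
    (hal : a ≤ l) (hbl : b ≤ l) {i : ℕ} (hi : i + 1 < n) (hia : i + 1 ≠ a) :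
    sigmaFamily q n i * projMatrix q n a b = projMatrix q n a b := by
  have h := isHeckeFamily_sigmaFamily q n
  have hQ : q ^ 2 ≠ 0 := pow_ne_zero _ hq0
  have ua := pow_two_pow_ne_one hq (m := a - 1) (by omega)
  have ub := pow_two_pow_ne_one hq (m := b - 1) (by omega)
  rw [projMatrix_eq q hq0 ha hb, h.symR_eq_symL hQ (by omega) ua,
    h.symR_eq_symL hQ (by omega) ub]
  rcases lt_or_ge i a with hlt | hge
  · rw [← mul_assoc, h.mul_symL hQ (by omega) ua (Nat.zero_le i) (by omega)]
  · have hc : Commute (sigmaFamily q n i) (symL (q ^ 2) (sigmaFamily q n) 0 (a - 1)) :=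
      Commute.symL fun j _ h2 => h.commute (by omega) (by omega) (by omega)
    rw [← mul_assoc, hc.eq, mul_assoc, h.mul_symL hQ (by omega) ub hge (by omega)]

theorem projMatrix_mul_sigmaFamily (hq0 : q ≠ 0)
    (hq : ∀ n : ℕ, 1 ≤ n → n ≤ l → q ^ (2 * n) ≠ 1) (hn : n = a + b) (ha : 1 ≤ a) (hb : 1 ≤ b)
    (hal : a ≤ l) (hbl : b ≤ l) {i : ℕ} (hi : i + 1 < n) (hia : i + 1 ≠ a) :
    projMatrix q n a b * sigmaFamily q n i = projMatrix q n a b := by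
  have h := isHeckeFamily_sigmaFamily q n
  have hQ : q ^ 2 ≠ 0 := pow_ne_zero _ hq0
  have ua := pow_two_pow_ne_one hq (m := a - 1) (by omega)
  have ub := pow_two_pow_ne_one hq (m := b - 1) (by omega)
  rw [projMatrix_eq q hq0 ha hb]
  rcases lt_or_ge i a with hlt | hge
  · have hc : Commute (sigmaFamily q n i) (symL (q ^ 2) (sigmaFamily q n) a (b - 1)) :=
      Commute.symL fun j _ h2 => h.commute (by omega) (by omega) (by omega)
    rw [mul_assoc, h.symR_eq_symL hQ (by omega) ub, ← hc.eq, ← mul_assoc,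
      h.symR_mul hQ (by omega) ua (Nat.zero_le i) (by omega)]
  · rw [mul_assoc, h.symR_mul hQ (by omega) ub hge (by omega)]

theorem projMatrix_mul_of_fixed (hq0 : q ≠ 0)
    (hq : ∀ n : ℕ, 1 ≤ n → n ≤ l → q ^ (2 * n) ≠ 1) (hn : n = a + b) (ha : 1 ≤ a) (hb : 1 ≤ b)
    (hal : a ≤ l) (hbl : b ≤ l) {f : Matrix (TWord n) (TWord n) ℂ}
    (hf : ∀ i, i + 1 < n → i + 1 ≠ a → sigmaFamily q n i * f = f) :
    projMatrix q n a b * f = f := by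
  have hQ : q ^ 2 ≠ 0 := pow_ne_zero _ hq0
  have ua := pow_two_pow_ne_one hq (m := a - 1) (by omega)
  have ub := pow_two_pow_ne_one hq (m := b - 1) (by omega)
  rw [projMatrix_eq q hq0 ha hb, mul_assoc,
    symR_mul_of_fixed hQ ub fun j h1 h2 => hf j (by omega) (by omega),
    symR_mul_of_fixed hQ ua fun j h1 h2 => hf j (by omega) (by omega)]

/-- A generator acting on a function of infinite words. -/
theorem sigmaFamily_mulVec {i : ℕ} (hi : i + 1 < n) (Φ : (ℕ → Fin 2) → ℂ) (w : TWord n) :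
    (sigmaFamily q n i).mulVec (fun v => Φ (extWord v)) w =
      if extWord w i = extWord w (i + 1) then Φ (extWord w)
      else if extWord w i = 0 then
        (1 - q ^ 2) * Φ (extWord w) + q ^ 2 * Φ (extWord w ∘ Equiv.swap i (i + 1))
      else Φ (extWord w ∘ Equiv.swap i (i + 1)) := by
  rw [sigmaFamily_of_lt q hi, sigmaMatrix_mulVec, extWord_swapWord, extWord_of_lt w hi,
    extWord_of_lt w (by omega)]
  simp only [Nat.add_sub_cancel]
  generalize w ⟨i, _⟩ = x
  generalize w ⟨i + 1, _⟩ = y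
  fin_cases x <;> fin_cases y <;> simp

theorem sigmaFamily_mulVec_eq_self_iff (hq0 : q ≠ 0) {i : ℕ} (hi : i + 1 < n) (g : TWord n → ℂ) :
    (sigmaFamily q n i).mulVec g = g ↔
      ∀ w : TWord n, extWord w i = 0 → extWord w (i + 1) = 1 →
        g (swapWord ⟨i + 1, by omega, hi⟩ w) = g w := by
  have hQ : q ^ 2 ≠ 0 := pow_ne_zero _ hq0
  rw [sigmaFamily_of_lt q hi]
  constructor
  · intro h w h0 h1
    have := congrFun h w
    rw [extWord_of_lt w (by omega)] at h0
    rw [extWord_of_lt w hi] at h1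
    rw [sigmaMatrix_mulVec] at this
    simp only [Nat.add_sub_cancel, h0, h1] at this
    rw [if_neg (by decide), if_pos (by decide)] at this
    apply mul_left_cancel₀ hQ
    linear_combination this
  · intro h
    funext w
    rw [sigmaMatrix_mulVec]
    simp only [Nat.add_sub_cancel]
    have h1 := h w
    have h2 := h (swapWord ⟨i + 1, by omega, hi⟩ w)
    rw [extWord_of_lt _ (by omega), extWord_of_lt _ hi] at h1 h2
    have e1 := swapWord_left ⟨i + 1, by omega, hi⟩ w (by simp; omega)
    have e2 := swapWord_right ⟨i + 1, by omega, hi⟩ w hi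
    simp only [Nat.add_sub_cancel] at e1 e2
    rw [e1, e2, swapWord_swapWord] at h2
    generalize w ⟨i, _⟩ = x at *
    generalize w ⟨i + 1, _⟩ = y at *
    have h01 : ∀ x : Fin 2, x = 0 ∨ x = 1 := by decide
    rcases h01 x with rfl | rfl <;> rcases h01 y with rfl | rfl
    · simp
    · rw [if_neg (by decide), if_pos (by decide), h1 rfl rfl]; ring
    · rw [if_neg (by decide), if_neg (by decide), h2 rfl rfl]
    · simp

theorem vecMul_sigmaFamily_swap {i : ℕ} (hi : i + 1 < n) {g : TWord n → ℂ}
    (hg : Matrix.vecMul g (sigmaFamily q n i) = g) (w : TWord n) (h0 : extWord w i = 0)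
    (h1 : extWord w (i + 1) = 1) :
    g (swapWord ⟨i + 1, by omega, hi⟩ w) = q ^ 2 * g w := by
  have := congrFun hg w
  rw [extWord_of_lt w (by omega)] at h0
  rw [extWord_of_lt w hi] at h1
  rw [sigmaFamily_of_lt q hi] at this
  simp only [Matrix.vecMul, dotProduct, sigmaMatrix, Matrix.of_apply, Nat.add_sub_cancel, h0, h1]
    at this
  simp only [if_neg (show ¬ (0 : Fin 2) = 1 by decide), if_pos (show (0 : Fin 2) < 1 by decide),
    mul_add, Finset.sum_add_distrib, mul_ite, mul_one, mul_zero, Finset.sum_ite_eq',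
    Finset.mem_univ, if_true] at this
  linear_combination this

end Projection

/-! ### Strand crossings in the stochastic representation -/

section Crossing

variable {q : ℂ} {n : ℕ}

/-- A strand at position `a` crossing the next `m` positions, which carry `c` letters `0`. A
letter `1` passes unchanged. A letter `0` reaches the other side with weight `(q ^ 2) ^ (m - c)`,
and with the complementary weight it is exchanged for one of the letters `1`. Here `Θ` collects the
dependence on the other positions, and its last argument counts the letter that comes out. -/
theorem ascProd_mulVec {a m : ℕ} (hn : a + m < n) {Θ : (ℕ → Fin 2) → ℕ → ℕ → ℂ}
    (hΘ : ∀ u v : ℕ → Fin 2, (∀ s, s < a ∨ a + m < s → u s = v s) → Θ u = Θ v) (w : TWord n) :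
    (ascProd (sigmaFamily q n) a m).mulVec (fun v => Θ (extWord v)
        (zeroCount (extWord v) a (a + m)) (if extWord v (a + m) = 0 then 1 else 0)) w =
      if extWord w a = 0 then
        (q ^ 2) ^ (m - zeroCount (extWord w) (a + 1) (a + 1 + m)) *
            Θ (extWord w) (zeroCount (extWord w) (a + 1) (a + 1 + m)) 1 +
          (1 - (q ^ 2) ^ (m - zeroCount (extWord w) (a + 1) (a + 1 + m))) *
            Θ (extWord w) (zeroCount (extWord w) (a + 1) (a + 1 + m) + 1) 0
      else Θ (extWord w) (zeroCount (extWord w) (a + 1) (a + 1 + m)) 0 := by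
  induction m generalizing a Θ w with
  | zero =>
    rw [ascProd_zero, Matrix.one_mulVec]
    simp only [add_zero, zeroCount_self, Nat.sub_zero, pow_zero]
    split_ifs <;> ring
  | succ m ih =>
    let Θ' : (ℕ → Fin 2) → ℕ → ℕ → ℂ := fun u c x => Θ u ((if u a = 0 then 1 else 0) + c) x
    have hΘ' : ∀ u v : ℕ → Fin 2, (∀ s, s < a + 1 ∨ a + 1 + m < s → u s = v s) →
        Θ' u = Θ' v := by
      intro u v h
      funext c x
      simp only [Θ']
      rw [h a (by omega), hΘ u v fun s hs => h s (by omega)]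
    have e : (fun v : TWord n => Θ (extWord v)
        (zeroCount (extWord v) a (a + (m + 1))) (if extWord v (a + (m + 1)) = 0 then 1 else 0)) =
        fun v => Θ' (extWord v) (zeroCount (extWord v) (a + 1) (a + 1 + m))
          (if extWord v (a + 1 + m) = 0 then 1 else 0) := by
      funext v
      simp only [Θ']
      rw [zeroCount_succ_left _ (by omega), show a + (m + 1) = a + 1 + m by omega]
    have ih' := funext fun v => ih (a := a + 1) (by omega) hΘ' v
    rw [e, ascProd_succ, ← Matrix.mulVec_mulVec, ih']
    let Φ : (ℕ → Fin 2) → ℂ := fun u =>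
      if u (a + 1) = 0 then
        (q ^ 2) ^ (m - zeroCount u (a + 1 + 1) (a + 1 + 1 + m)) *
            Θ' u (zeroCount u (a + 1 + 1) (a + 1 + 1 + m)) 1 +
          (1 - (q ^ 2) ^ (m - zeroCount u (a + 1 + 1) (a + 1 + 1 + m))) *
            Θ' u (zeroCount u (a + 1 + 1) (a + 1 + 1 + m) + 1) 0
      else Θ' u (zeroCount u (a + 1 + 1) (a + 1 + 1 + m)) 0
    change (sigmaFamily q n a).mulVec (fun v => Φ (extWord v)) w = _
    rw [sigmaFamily_mulVec (by omega)]
    generalize extWord w = u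
    have hs : Θ (u ∘ Equiv.swap a (a + 1)) = Θ u := hΘ _ _ fun s hs => by
      rw [Function.comp_apply, Equiv.swap_apply_of_ne_of_ne (by omega) (by omega)]
    have hc : zeroCount (u ∘ Equiv.swap a (a + 1)) (a + 1 + 1) (a + 1 + 1 + m) =
        zeroCount u (a + 1 + 1) (a + 1 + 1 + m) := zeroCount_congr fun s h1 h2 => by
      rw [Function.comp_apply, Equiv.swap_apply_of_ne_of_ne (by omega) (by omega)]
    have hle := zeroCount_le u (a + 1 + 1) (a + 1 + 1 + m)
    simp only [Φ, Θ', hs, hc, Function.comp_apply, Equiv.swap_apply_left, Equiv.swap_apply_right]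
    rw [zeroCount_succ_left u (show a + 1 < a + 1 + (m + 1) by omega),
      show a + 1 + (m + 1) = a + 1 + 1 + m by omega]
    generalize zeroCount u (a + 1 + 1) (a + 1 + 1 + m) = c at *
    have h01 : ∀ x : Fin 2, x = 0 ∨ x = 1 := by decide
    have h10 : ¬ (1 : Fin 2) = 0 := by decide
    have h10' : ¬ (0 : Fin 2) = 1 := by decide
    have e1 : m + 1 - (c + 1) = m - c := by omega
    have e2 : (q ^ 2) ^ (m + 1 - c) = (q ^ 2) ^ (m - c) * q ^ 2 := by
      rw [← pow_succ]; congr 1; omega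
    rcases h01 (u a) with h | h <;> rcases h01 (u (a + 1)) with h' | h' <;>
      simp only [h, h', h10, h10', if_true, if_false, zero_add, add_comm 1 c, add_comm 1 (c + 1),
        e1, e2]
    ring

/-- A bundle of `p` strands crossing `m` strands. The function on the left has the value `1` on
the words with `X` letters `0` before position `o + m` and `Y` after it when `o = b`; each
strand of the bundle raises the argument `o` by one. -/
theorem crossing_mulVec {l : ℕ} (hq0 : q ≠ 0) (hq : ∀ n : ℕ, 1 ≤ n → n ≤ l → q ^ (2 * n) ≠ 1)
    {b o p m : ℕ} (hbo : b ≤ o) (hpl : o + p ≤ b + l) (hn : o + p + m ≤ n) (X Y : ℤ)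
    (w : TWord n) :
    (crossing (sigmaFamily q n) o p m).mulVec (fun v => jTrans q m (zeroCount (extWord v) b o)
        (zeroCount (extWord v) o (o + m)) (X - zeroCount (extWord v) 0 b)
        (Y - zeroCount (extWord v) (o + m) n)) w =
      jTrans q m (zeroCount (extWord w) b (o + p))
        (zeroCount (extWord w) (o + p) (o + p + m)) (X - zeroCount (extWord w) 0 b)
        (Y - zeroCount (extWord w) (o + p + m) n) := by
  induction p generalizing o w with
  | zero => simp [crossing]
  | succ p ih =>
    rw [crossing, ← Matrix.mulVec_mulVec]
    have e : (ascProd (sigmaFamily q n) o m).mulVec (fun v => jTrans q m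
        (zeroCount (extWord v) b o) (zeroCount (extWord v) o (o + m))
        (X - zeroCount (extWord v) 0 b) (Y - zeroCount (extWord v) (o + m) n)) =
        fun v => jTrans q m (zeroCount (extWord v) b (o + 1))
          (zeroCount (extWord v) (o + 1) (o + 1 + m)) (X - zeroCount (extWord v) 0 b)
          (Y - zeroCount (extWord v) (o + 1 + m) n) := by
      funext v
      let Θ : (ℕ → Fin 2) → ℕ → ℕ → ℂ := fun u c x => jTrans q m (zeroCount u b o) c
        (X - zeroCount u 0 b) (Y - zeroCount u (o + m + 1) n - x)
      have hΘ : ∀ u v : ℕ → Fin 2, (∀ s, s < o ∨ o + m < s → u s = v s) → Θ u = Θ v := by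
        intro u v h
        simp only [Θ]
        rw [zeroCount_congr fun s _ h2 => h s (by omega),
          zeroCount_congr (a := 0) fun s _ h2 => h s (by omega),
          zeroCount_congr (a := o + m + 1) fun s h1 _ => h s (by omega)]
      have key := ascProd_mulVec (q := q) (n := n) (a := o) (m := m) (by omega) hΘ v
      have e1 : (fun v : TWord n => jTrans q m
          (zeroCount (extWord v) b o) (zeroCount (extWord v) o (o + m))
          (X - zeroCount (extWord v) 0 b) (Y - zeroCount (extWord v) (o + m) n)) =
          fun v => Θ (extWord v) (zeroCount (extWord v) o (o + m))
            (if extWord v (o + m) = 0 then 1 else 0) := by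
        funext v
        simp only [Θ]
        rw [zeroCount_succ_left _ (show o + m < n by omega)]
        congr 1
        push_cast
        ring
      rw [e1, key]
      simp only [Θ]
      generalize extWord v = u
      rw [zeroCount_succ_right u hbo, show o + 1 + m = o + m + 1 by omega]
      have hle := zeroCount_le u (o + 1) (o + m + 1)
      have hle' := zeroCount_le u b o
      generalize zeroCount u (o + 1) (o + m + 1) = c at *
      by_cases hu : u o = 0
      · have hpow : (q ^ 2) ^ (m - c) = q ^ (2 * ((m : ℤ) - c)) := by
          rw [← pow_mul, ← zpow_natCast]; congr 1; push_cast; omega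
        rw [if_pos hu, if_pos hu, hpow]
        have := jTrans_succ hq0 hq (r := zeroCount u b o) (by omega) m c
          (X - zeroCount u 0 b) (Y - zeroCount u (o + m + 1) n)
        push_cast
        rw [this, sub_zero]
      · rw [if_neg hu, if_neg hu]
        push_cast
        rw [sub_zero, add_zero]
    rw [e, ih (by omega) (by omega) (by omega)]
    rw [show o + 1 + p = o + (p + 1) by omega]

end Crossing

/-! ### The bases -/

section Bases

variable {q : ℂ} {l n a b : ℕ}

theorem zeroSum_blockWord_left {n a i j : ℕ} (ha : a ≤ n) (hi : i ≤ a) :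
    zeroSum (extWord (blockWord n a i j)) 0 a = triangle i := by
  have e : zeroSum (extWord (blockWord n a i j)) 0 a =
      ∑ s ∈ Finset.range a, if s < i then s else 0 := by
    rw [zeroSum, Finset.range_eq_Ico]
    refine Finset.sum_congr rfl fun s hs => ?_
    have hs := (Finset.mem_Ico.mp hs).2
    rw [extWord_of_lt _ (by omega)]
    by_cases h : s < i <;> simp [blockWord, hs, h]
  rw [e, ← Finset.sum_filter, triangle]
  congr 1
  ext s
  simp
  omega

theorem zeroSum_blockWord_right {n a i j : ℕ} (hj : a + j ≤ n) :
    zeroSum (extWord (blockWord n a i j)) a n = a * j + triangle j := by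
  have e : zeroSum (extWord (blockWord n a i j)) a n =
      ∑ s ∈ Finset.Ico a n, if s < a + j then s else 0 := by
    refine Finset.sum_congr rfl fun s hs => ?_
    have hs := Finset.mem_Ico.mp hs
    rw [extWord_of_lt _ (by omega)]
    by_cases h : s < a + j <;> simp [blockWord, not_lt.mpr hs.1, h]
  rw [e, ← Finset.sum_filter,
    show Finset.filter (fun s => s < a + j) (Finset.Ico a n) = Finset.Ico a (a + j) by
      ext s; simp; omega, Finset.sum_Ico_eq_sum_range, Nat.add_sub_cancel_left,
    Finset.sum_add_distrib, triangle]
  simp [mul_comm]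

/-- The normalisation `∑ (q ^ 2) ^ (zeroSum)` over the words with block contents `i`, `j`. -/
noncomputable def classWeight (q : ℂ) (a b i j : ℕ) : ℂ :=
  (q ^ 2) ^ (triangle i + (a * j + triangle j)) * (qBinom q a i * qBinom q b j)

theorem classWeight_ne_zero (hq0 : q ≠ 0) (hq : ∀ n : ℕ, 1 ≤ n → n ≤ l → q ^ (2 * n) ≠ 1)
    (hal : a ≤ l) (hbl : b ≤ l) {i j : ℕ} (hi : i ≤ a) (hj : j ≤ b) :
    classWeight q a b i j ≠ 0 :=
  mul_ne_zero (pow_ne_zero _ (pow_ne_zero _ hq0))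
    (mul_ne_zero (qBinom_ne_zero hq hal hi) (qBinom_ne_zero hq hbl hj))

/-- A function depending on block contents only is fixed by the symmetriser. -/
theorem projMatrix_mulVec_of_zeroCount (hq0 : q ≠ 0)
    (hq : ∀ n : ℕ, 1 ≤ n → n ≤ l → q ^ (2 * n) ≠ 1) (hn : n = a + b) (ha : 1 ≤ a) (hb : 1 ≤ b)
    (hal : a ≤ l) (hbl : b ≤ l) (G : ℕ → ℕ → ℂ) :
    (projMatrix q n a b).mulVec
        (fun w => G (zeroCount (extWord w) 0 a) (zeroCount (extWord w) a n)) =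
      fun w => G (zeroCount (extWord w) 0 a) (zeroCount (extWord w) a n) := by
  set g : TWord n → ℂ := fun w => G (zeroCount (extWord w) 0 a) (zeroCount (extWord w) a n)
  let f : Matrix (TWord n) (TWord n) ℂ := Matrix.of fun w _ => g w
  have hf : ∀ M : Matrix (TWord n) (TWord n) ℂ, ∀ w v, (M * f) w v = M.mulVec g w := by
    intro M w v
    simp [Matrix.mul_apply, Matrix.mulVec, dotProduct, f]
  have key : projMatrix q n a b * f = f := by
    apply projMatrix_mul_of_fixed hq0 hq hn ha hb hal hbl
    intro i hi hia
    ext w v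
    rw [hf, (sigmaFamily_mulVec_eq_self_iff hq0 hi g).mpr]
    · rfl
    · intro w _ _
      simp only [g]
      rw [extWord_swapWord]
      simp only [Nat.add_sub_cancel]
      rw [zeroCount_comp_swap _ (by omega), zeroCount_comp_swap _ (by omega)]
  funext w
  rw [← hf _ w w, key]
  rfl

/-- The entries of the symmetriser. All rows with the same block contents agree, because the
columns are fixed by the generators from the left. A row is an eigenvector from the right, so it is
proportional to `(q ^ 2) ^ zeroSum` on every class of words, and the factor is found by letting the
symmetriser act on the indicator function of the class. -/
theorem projMatrix_apply (hq0 : q ≠ 0)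
    (hq : ∀ n : ℕ, 1 ≤ n → n ≤ l → q ^ (2 * n) ≠ 1) (hn : n = a + b) (ha : 1 ≤ a) (hb : 1 ≤ b)
    (hal : a ≤ l) (hbl : b ≤ l) (w v : TWord n) :
    projMatrix q n a b w v =
      blockWeight q (zeroCount (extWord w) 0 a) 0 a (extWord v) *
        blockWeight q (zeroCount (extWord w) a n) a n (extWord v) /
        classWeight q a b (zeroCount (extWord w) 0 a) (zeroCount (extWord w) a n) := by
  have hQ : q ^ 2 ≠ 0 := pow_ne_zero _ hq0
  set P := projMatrix q n a b with hP
  have hrow : ∀ v : TWord n,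
      (q ^ 2) ^ zeroSum (extWord (blockWord n a (zeroCount (extWord v) 0 a)
        (zeroCount (extWord v) a n))) 0 n * P w v =
      (q ^ 2) ^ zeroSum (extWord v) 0 n *
        P w (blockWord n a (zeroCount (extWord v) 0 a) (zeroCount (extWord v) a n)) := by
    refine eq_blockWord_of_swap (g := P w) (by omega) ?_
    rintro ⟨i, hi1, hi2⟩ v hia h0 h1
    obtain ⟨i, rfl⟩ : ∃ i', i = i' + 1 := ⟨i - 1, by omega⟩
    refine vecMul_sigmaFamily_swap hi2 ?_ v h0 h1
    have := projMatrix_mul_sigmaFamily hq0 hq hn ha hb hal hbl hi2 hia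
    rw [← hP] at this
    funext x
    exact congrFun (congrFun this w) x
  set i := zeroCount (extWord v) 0 a with hi
  set j := zeroCount (extWord v) a n with hj
  have hia : i ≤ a := by simpa using zeroCount_le (extWord v) 0 a
  have hjb : j ≤ b := by have := zeroCount_le (extWord v) a n; omega
  have hsum : (∑ x : TWord n, P w x * if zeroCount (extWord x) 0 a = i ∧
      zeroCount (extWord x) a n = j then 1 else 0) =
      if zeroCount (extWord w) 0 a = i ∧ zeroCount (extWord w) a n = j then 1 else 0 :=
    congrFun (projMatrix_mulVec_of_zeroCount hq0 hq hn ha hb hal hbl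
      (fun i' j' => if i' = i ∧ j' = j then 1 else 0)) w
  set B := blockWord n a i j with hB
  have hclass : classWeight q a b i j * P w B = (q ^ 2) ^ zeroSum (extWord B) 0 n *
      if zeroCount (extWord w) 0 a = i ∧ zeroCount (extWord w) a n = j then 1 else 0 := by
    rw [classWeight, ← wordSum_two_blocks hq hn hal hbl i j, wordSum, ← hsum, Finset.sum_mul,
      Finset.mul_sum]
    refine Finset.sum_congr rfl fun x _ => ?_
    simp only [blockWeight]
    by_cases h1 : zeroCount (extWord x) 0 a = i
    · by_cases h2 : zeroCount (extWord x) a n = j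
      · have := hrow x
        rw [h1, h2, ← hB] at this
        rw [if_pos h1, if_pos h2, if_pos ⟨h1, h2⟩, ← pow_add,
          zeroSum_add _ (Nat.zero_le a) (by omega), ← this, mul_one]
      · simp [h2]
    · simp [h1]
  have hne := classWeight_ne_zero hq0 hq hal hbl hia hjb
  have hv := hrow v
  rw [← hi, ← hj, ← hB] at hv
  have hB0 : (q ^ 2) ^ zeroSum (extWord B) 0 n ≠ 0 := pow_ne_zero _ hQ
  have hmain : classWeight q a b i j * P w v = (q ^ 2) ^ zeroSum (extWord v) 0 n *
      if zeroCount (extWord w) 0 a = i ∧ zeroCount (extWord w) a n = j then 1 else 0 := by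
    apply mul_left_cancel₀ hB0
    linear_combination classWeight q a b i j * hv + (q ^ 2) ^ zeroSum (extWord v) 0 n * hclass
  have hPv : P w v = ((q ^ 2) ^ zeroSum (extWord v) 0 n *
      if zeroCount (extWord w) 0 a = i ∧ zeroCount (extWord w) a n = j then 1 else 0) /
        classWeight q a b i j := by
    rw [← hmain, mul_div_cancel_left₀ _ hne]
  rw [hPv]
  simp only [blockWeight, ← hi, ← hj]
  by_cases h1 : zeroCount (extWord w) 0 a = i
  · by_cases h2 : zeroCount (extWord w) a n = j
    · rw [if_pos ⟨h1, h2⟩, if_pos h1.symm, if_pos h2.symm, h1, h2, ← pow_add,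
        zeroSum_add _ (Nat.zero_le a) (by omega), mul_one]
    · simp [h2, Ne.symm h2]
  · simp [h1, Ne.symm h1]

/-- The block contents of a word as an index of the bases. -/
def content (a b n : ℕ) (hn : n = a + b) (w : TWord n) : Fin (a + 1) × Fin (b + 1) :=
  (⟨zeroCount (extWord w) 0 a, by have := zeroCount_le (extWord w) 0 a; omega⟩,
    ⟨zeroCount (extWord w) a n, by have := zeroCount_le (extWord w) a n; omega⟩)

theorem content_eq_iff (hn : n = a + b) (w : TWord n) (x : Fin (a + 1) × Fin (b + 1)) :
    content a b n hn w = x ↔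
      zeroCount (extWord w) 0 a = x.1 ∧ zeroCount (extWord w) a n = x.2 := by
  rw [Prod.ext_iff, Fin.ext_iff, Fin.ext_iff]
  rfl

theorem content_blockWord (hn : n = a + b) (x : Fin (a + 1) × Fin (b + 1)) :
    content a b n hn (blockWord n a x.1 x.2) = x := by
  have h1 := x.1.2
  have h2 := x.2.2
  rw [content_eq_iff]
  exact ⟨zeroCount_blockWord_left (by omega) (by omega),
    zeroCount_blockWord_right (by omega)⟩

theorem rowVec_eq (x : Fin (a + 1) × Fin (b + 1)) :
    rowVec q a b n x = projMatrix q n a b (blockWord n a x.1 x.2) := by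
  rw [rowVec, Matrix.single_one_vecMul]
  rfl

theorem rowVec_apply (hq0 : q ≠ 0)
    (hq : ∀ n : ℕ, 1 ≤ n → n ≤ l → q ^ (2 * n) ≠ 1) (hn : n = a + b) (ha : 1 ≤ a) (hb : 1 ≤ b)
    (hal : a ≤ l) (hbl : b ≤ l) (x : Fin (a + 1) × Fin (b + 1)) (v : TWord n) :
    rowVec q a b n x v = blockWeight q x.1 0 a (extWord v) * blockWeight q x.2 a n (extWord v) /
      classWeight q a b x.1 x.2 := by
  obtain ⟨h1, h2⟩ := (content_eq_iff hn _ x).mp (content_blockWord hn x)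
  rw [rowVec_eq, projMatrix_apply hq0 hq hn ha hb hal hbl, h1, h2]

theorem projMatrix_eq_rowVec (hq0 : q ≠ 0)
    (hq : ∀ n : ℕ, 1 ≤ n → n ≤ l → q ^ (2 * n) ≠ 1) (hn : n = a + b) (ha : 1 ≤ a) (hb : 1 ≤ b)
    (hal : a ≤ l) (hbl : b ≤ l) (w : TWord n) :
    projMatrix q n a b w = rowVec q a b n (content a b n hn w) := by
  funext v
  rw [projMatrix_apply hq0 hq hn ha hb hal hbl, rowVec_apply hq0 hq hn ha hb hal hbl]
  rfl

/-- The basis vectors of column type are the indicator functions of block contents. -/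
theorem colVec_eq (hq0 : q ≠ 0)
    (hq : ∀ n : ℕ, 1 ≤ n → n ≤ l → q ^ (2 * n) ≠ 1) (hn : n = a + b) (ha : 1 ≤ a) (hb : 1 ≤ b)
    (hal : a ≤ l) (hbl : b ≤ l) (x : Fin (a + 1) × Fin (b + 1)) :
    colVec q a b n x = fun w => if content a b n hn w = x then 1 else 0 := by
  have hx1 := x.1.2
  have hx2 := x.2.2
  obtain ⟨h1, h2⟩ := (content_eq_iff hn _ x).mp (content_blockWord hn x)
  have hb1 := qBinom_ne_zero hq hal (show (x.1 : ℕ) ≤ a by omega)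
  have hb2 := qBinom_ne_zero hq hbl (show (x.2 : ℕ) ≤ b by omega)
  have hQ : ∀ m : ℕ, (q ^ 2) ^ m ≠ 0 := fun m => pow_ne_zero _ (pow_ne_zero _ hq0)
  funext w
  rw [colVec, Pi.smul_apply, Matrix.mulVec_single_one, Matrix.col_apply,
    projMatrix_apply hq0 hq hn ha hb hal hbl, blockWeight, blockWeight, h1, h2,
    zeroSum_blockWord_left (by omega) (by omega), zeroSum_blockWord_right (by omega),
    smul_eq_mul]
  by_cases h : content a b n hn w = x
  · obtain ⟨h3, h4⟩ := (content_eq_iff hn w x).mp h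
    rw [if_pos h, if_pos h3.symm, if_pos h4.symm, h3, h4, ← pow_add, classWeight]
    field_simp [hQ]
  · rw [if_neg h]
    rw [content_eq_iff] at h
    by_cases h3 : (x.1 : ℕ) = zeroCount (extWord w) 0 a
    · rw [if_neg (fun h4 => h ⟨h3.symm, Eq.symm h4⟩)]; simp
    · rw [if_neg h3]; simp

/-- The symmetriser acting on column vectors, in terms of the two bases. -/
theorem projMatrix_mulVec (hq0 : q ≠ 0)
    (hq : ∀ n : ℕ, 1 ≤ n → n ≤ l → q ^ (2 * n) ≠ 1) (hn : n = a + b) (ha : 1 ≤ a) (hb : 1 ≤ b)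
    (hal : a ≤ l) (hbl : b ≤ l) (g : TWord n → ℂ) :
    (projMatrix q n a b).mulVec g = ∑ x, (rowVec q a b n x ⬝ᵥ g) • colVec q a b n x := by
  funext w
  rw [Finset.sum_apply, Matrix.mulVec, projMatrix_eq_rowVec hq0 hq hn ha hb hal hbl]
  simp [colVec_eq hq0 hq hn ha hb hal hbl]

/-- The symmetriser acting on row vectors, in terms of the two bases. -/
theorem vecMul_projMatrix (hq0 : q ≠ 0)
    (hq : ∀ n : ℕ, 1 ≤ n → n ≤ l → q ^ (2 * n) ≠ 1) (hn : n = a + b) (ha : 1 ≤ a) (hb : 1 ≤ b)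
    (hal : a ≤ l) (hbl : b ≤ l) (h : TWord n → ℂ) :
    Matrix.vecMul h (projMatrix q n a b) =
      ∑ x, (h ⬝ᵥ colVec q a b n x) • rowVec q a b n x := by
  have hP : projMatrix q n a b =
      ∑ x, Matrix.vecMulVec (colVec q a b n x) (rowVec q a b n x) := by
    ext w v
    rw [projMatrix_eq_rowVec hq0 hq hn ha hb hal hbl, Matrix.sum_apply]
    simp [Matrix.vecMulVec_apply, colVec_eq hq0 hq hn ha hb hal hbl]
  rw [hP, Matrix.vecMul_sum]
  simp [Matrix.vecMul_vecMulVec]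

theorem rowVec_dotProduct_colVec (hq0 : q ≠ 0)
    (hq : ∀ n : ℕ, 1 ≤ n → n ≤ l → q ^ (2 * n) ≠ 1) (hn : n = a + b) (ha : 1 ≤ a) (hb : 1 ≤ b)
    (hal : a ≤ l) (hbl : b ≤ l) (x y : Fin (a + 1) × Fin (b + 1)) :
    rowVec q a b n x ⬝ᵥ colVec q a b n y = if x = y then 1 else 0 := by
  have h := congrFun (projMatrix_mulVec_of_zeroCount hq0 hq hn ha hb hal hbl
    (fun i j => if i = (y.1 : ℕ) ∧ j = (y.2 : ℕ) then 1 else 0)) (blockWord n a x.1 x.2)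
  simp only [← content_eq_iff hn, content_blockWord] at h
  rw [rowVec_eq, colVec_eq hq0 hq hn ha hb hal hbl]
  exact h

theorem isBasisOf_colVec (hq0 : q ≠ 0)
    (hq : ∀ n : ℕ, 1 ≤ n → n ≤ l → q ^ (2 * n) ≠ 1) (hn : n = a + b) (ha : 1 ≤ a) (hb : 1 ≤ b)
    (hal : a ≤ l) (hbl : b ≤ l) :
    IsBasisOf (colVec q a b n) (LinearMap.range (projMatrix q n a b).mulVecLin) := by
  constructor
  · rw [Fintype.linearIndependent_iff]
    intro c hc x
    have := congrArg (fun g => rowVec q a b n x ⬝ᵥ g) hc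
    simpa [dotProduct_sum, rowVec_dotProduct_colVec hq0 hq hn ha hb hal hbl] using this
  · apply le_antisymm
    · rw [Submodule.span_le]
      rintro _ ⟨x, rfl⟩
      exact Submodule.smul_mem _ _ ⟨_, rfl⟩
    · rintro _ ⟨g, rfl⟩
      rw [Matrix.mulVecLin_apply, projMatrix_mulVec hq0 hq hn ha hb hal hbl]
      exact Submodule.sum_mem _ fun x _ =>
        Submodule.smul_mem _ _ (Submodule.subset_span ⟨x, rfl⟩)

theorem isBasisOf_rowVec (hq0 : q ≠ 0)
    (hq : ∀ n : ℕ, 1 ≤ n → n ≤ l → q ^ (2 * n) ≠ 1) (hn : n = a + b) (ha : 1 ≤ a) (hb : 1 ≤ b)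
    (hal : a ≤ l) (hbl : b ≤ l) :
    IsBasisOf (rowVec q a b n) (LinearMap.range (projMatrix q n a b).vecMulLinear) := by
  constructor
  · rw [Fintype.linearIndependent_iff]
    intro c hc x
    have := congrArg (fun g => g ⬝ᵥ colVec q a b n x) hc
    simpa [sum_dotProduct, rowVec_dotProduct_colVec hq0 hq hn ha hb hal hbl] using this
  · apply le_antisymm
    · rw [Submodule.span_le]
      rintro _ ⟨x, rfl⟩
      exact ⟨_, rfl⟩
    · rintro _ ⟨g, rfl⟩
      rw [Matrix.vecMulLinear_apply, vecMul_projMatrix hq0 hq hn ha hb hal hbl]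
      exact Submodule.sum_mem _ fun x _ =>
        Submodule.smul_mem _ _ (Submodule.subset_span ⟨x, rfl⟩)

end Bases

/-! ### The matrix entries -/

/-- The contribution of one crossing to the entry formula: the words with block contents `x` are cut
into four blocks, of which the middle two cross. -/
theorem rowVec_dotProduct_crossing {q : ℂ} (hq0 : q ≠ 0) {k l p : ℕ}
    (hq : ∀ n : ℕ, 1 ≤ n → n ≤ l → q ^ (2 * n) ≠ 1) (hk : 1 ≤ k) (hkl : k ≤ l) (hp : p ≤ k)
    (x : Fin (k + 1) × Fin (l + 1)) (y : Fin (l + 1) × Fin (k + 1)) :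
    rowVec q k l (k + l) x ⬝ᵥ (crossing (sigmaFamily q (k + l)) (k - p) p (l - k + p)).mulVec
        (colVec q l k (k + l) y) =
      if (x.1 : ℕ) + x.2 = y.1 + y.2 then
        ∑ r ∈ Finset.range (p + 1), ∑ s ∈ Finset.range (l - k + p + 1),
          (qBinom q ((k : ℤ) - p) (((x.1 : ℕ) : ℤ) - r) * qBinom q p r *
            q ^ (2 * (r : ℤ) * (k - p - (x.1 : ℕ) + r)) / qBinom q k (x.1 : ℕ)) *
          (qBinom q ((k : ℤ) - p) (((x.2 : ℕ) : ℤ) - s) * qBinom q ((l : ℤ) - k + p) s *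
            q ^ (2 * (((x.2 : ℕ) : ℤ) - s) * (l - k + p - s)) / qBinom q l (x.2 : ℕ)) *
          jWeight q ((l : ℤ) - k + p) r s (((y.1 : ℕ) : ℤ) - (x.1 : ℕ) + r)
            (((y.2 : ℕ) : ℤ) - (x.2 : ℕ) + s)
      else 0 := by
  obtain ⟨⟨k', hk'⟩, ⟨l', hl'⟩⟩ := x
  obtain ⟨⟨lt, hlt⟩, ⟨kt, hkt⟩⟩ := y
  simp only
  set m := l - k + p with hm
  have hmz : (l : ℤ) - k + p = (m : ℤ) := by omega
  -- before the crossing the bundle is empty, and the weight is an indicator function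
  have hcol : colVec q l k (k + l) (⟨lt, hlt⟩, ⟨kt, hkt⟩) = fun v => jTrans q m
      (zeroCount (extWord v) (k - p) (k - p)) (zeroCount (extWord v) (k - p) (k - p + m))
      ((lt : ℤ) - zeroCount (extWord v) 0 (k - p))
      ((kt : ℤ) - zeroCount (extWord v) (k - p + m) (k + l)) := by
    rw [colVec_eq hq0 hq (add_comm k l) (by omega) hk le_rfl hkl]
    funext v
    have h0 := zeroCount_add (extWord v) (Nat.zero_le (k - p)) (show k - p ≤ l by omega)
    rw [zeroCount_self, Nat.cast_zero, jTrans_zero, show k - p + m = l by omega]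
    refine if_congr ?_ rfl rfl
    rw [content_eq_iff]
    simp only
    omega
  have hcross : (crossing (sigmaFamily q (k + l)) (k - p) p m).mulVec
      (colVec q l k (k + l) (⟨lt, hlt⟩, ⟨kt, hkt⟩)) = fun v => jTrans q m
      (zeroCount (extWord v) (k - p) k) (zeroCount (extWord v) k (k + m))
      ((lt : ℤ) - zeroCount (extWord v) 0 (k - p))
      ((kt : ℤ) - zeroCount (extWord v) (k + m) (k + l)) := by
    funext w
    rw [hcol, crossing_mulVec hq0 hq le_rfl (by omega) (by omega),
      show k - p + p = k by omega]
  rw [hcross]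
  -- distribute the class of the word over the possible contents `r`, `s` of the middle blocks
  have hterm : ∀ u : ℕ → Fin 2,
      blockWeight q k' 0 k u * blockWeight q l' k (k + l) u *
        jTrans q m (zeroCount u (k - p) k) (zeroCount u k (k + m))
          ((lt : ℤ) - zeroCount u 0 (k - p)) ((kt : ℤ) - zeroCount u (k + m) (k + l)) =
      ∑ r ∈ Finset.range (p + 1), ∑ s ∈ Finset.range (m + 1),
        if r ≤ k' ∧ s ≤ l' then
          blockWeight q (k' - r) 0 (k - p) u * blockWeight q r (k - p) k u *
            blockWeight q s k (k + m) u * blockWeight q (l' - s) (k + m) (k + l) u *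
            jTrans q m r s ((lt : ℤ) - k' + r) ((kt : ℤ) - l' + s)
        else 0 := by
    intro u
    have b1 := zeroCount_le u (k - p) k
    have b2 := zeroCount_le u k (k + m)
    have a1 := zeroCount_add u (Nat.zero_le (k - p)) (Nat.sub_le k p)
    have a2 := zeroCount_add u (show k ≤ k + m by omega) (show k + m ≤ k + l by omega)
    have s1 := zeroSum_add u (Nat.zero_le (k - p)) (Nat.sub_le k p)
    have s2 := zeroSum_add u (show k ≤ k + m by omega) (show k + m ≤ k + l by omega)
    rw [Finset.sum_eq_single (zeroCount u (k - p) k), Finset.sum_eq_single (zeroCount u k (k + m))]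
    · simp only [blockWeight, if_true]
      by_cases h1 : zeroCount u 0 k = k'
      · by_cases h2 : zeroCount u k (k + l) = l'
        · rw [if_pos h1, if_pos h2, if_pos (by omega), if_pos (by omega), if_pos (by omega),
            ← s1, ← s2, pow_add, pow_add,
            show (lt : ℤ) - k' + zeroCount u (k - p) k = lt - zeroCount u 0 (k - p) by omega,
            show (kt : ℤ) - l' + zeroCount u k (k + m) = kt - zeroCount u (k + m) (k + l) by omega]
          ring
        · rw [if_neg h2]
          split_ifs <;> first | omega | simp
      · rw [if_neg h1]
        split_ifs <;> first | omega | simp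
    · intro s _ hs
      rw [blockWeight, blockWeight, blockWeight, if_neg (Ne.symm hs)]
      simp
    · intro h
      exact absurd (Finset.mem_range.mpr (by omega)) h
    · intro r _ hr
      refine Finset.sum_eq_zero fun s _ => ?_
      rw [blockWeight, blockWeight, if_neg (Ne.symm hr)]
      simp
    · intro h
      exact absurd (Finset.mem_range.mpr (by omega)) h
  have hdot : rowVec q k l (k + l) (⟨k', hk'⟩, ⟨l', hl'⟩) ⬝ᵥ (fun v => jTrans q m
      (zeroCount (extWord v) (k - p) k) (zeroCount (extWord v) k (k + m))
      ((lt : ℤ) - zeroCount (extWord v) 0 (k - p))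
      ((kt : ℤ) - zeroCount (extWord v) (k + m) (k + l))) =
      ∑ r ∈ Finset.range (p + 1), ∑ s ∈ Finset.range (m + 1),
        if r ≤ k' ∧ s ≤ l' then
          wordSum (k + l) (fun u => blockWeight q (k' - r) 0 (k - p) u *
            blockWeight q r (k - p) k u * blockWeight q s k (k + m) u *
            blockWeight q (l' - s) (k + m) (k + l) u) / classWeight q k l k' l' *
            jTrans q m r s ((lt : ℤ) - k' + r) ((kt : ℤ) - l' + s)
        else 0 := by
    have : ∀ v : TWord (k + l), rowVec q k l (k + l) (⟨k', hk'⟩, ⟨l', hl'⟩) v * jTrans q m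
        (zeroCount (extWord v) (k - p) k) (zeroCount (extWord v) k (k + m))
        ((lt : ℤ) - zeroCount (extWord v) 0 (k - p))
        ((kt : ℤ) - zeroCount (extWord v) (k + m) (k + l)) =
        (∑ r ∈ Finset.range (p + 1), ∑ s ∈ Finset.range (m + 1),
        if r ≤ k' ∧ s ≤ l' then
          blockWeight q (k' - r) 0 (k - p) (extWord v) * blockWeight q r (k - p) k (extWord v) *
            blockWeight q s k (k + m) (extWord v) *
            blockWeight q (l' - s) (k + m) (k + l) (extWord v) *
            jTrans q m r s ((lt : ℤ) - k' + r) ((kt : ℤ) - l' + s)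
        else 0) / classWeight q k l k' l' := by
      intro v
      rw [rowVec_apply hq0 hq rfl hk (by omega) hkl le_rfl, ← hterm]
      ring
    rw [dotProduct, Finset.sum_congr rfl fun v _ => this v, ← Finset.sum_div, Finset.sum_comm,
      Finset.sum_div]
    refine Finset.sum_congr rfl fun r _ => ?_
    rw [Finset.sum_comm, Finset.sum_div]
    refine Finset.sum_congr rfl fun s _ => ?_
    split_ifs
    · rw [← Finset.sum_mul, wordSum]
      ring
    · simp
  rw [hdot]
  by_cases hcons : k' + l' = lt + kt
  · rw [if_pos hcons]
    refine Finset.sum_congr rfl fun r hr => Finset.sum_congr rfl fun s hs => ?_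
    have hr' := Finset.mem_range.mp hr
    have hs' := Finset.mem_range.mp hs
    by_cases hrs : r ≤ k' ∧ s ≤ l'
    · obtain ⟨hrk, hsl⟩ := hrs
      rw [if_pos ⟨hrk, hsl⟩, jTrans, if_pos (by omega), hmz,
        wordSum_four_blocks hq (show k = (k - p) + p by omega) rfl
          (show k + l = k + m + (k - p) by omega) (by omega) (by omega) (by omega) (by omega),
        classWeight, Nat.cast_sub hrk, Nat.cast_sub hsl, Nat.cast_sub hp]
      have hb1 := qBinom_ne_zero hq hkl (show k' ≤ k by omega)
      have hb2 := qBinom_ne_zero hq le_rfl (show l' ≤ l by omega)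
      -- the cross terms of the triangular numbers give the powers of `q` in the formula
      have hexp : (q ^ 2) ^ (triangle (k' - r) + ((k - p) * r + triangle r) +
          (k * s + triangle s) + ((k + m) * (l' - s) + triangle (l' - s))) =
          (q ^ 2) ^ (triangle k' + (k * l' + triangle l')) *
            (q ^ (2 * (r : ℤ) * (k - p - k' + r)) * q ^ (2 * ((l' : ℤ) - s) * (m - s))) := by
        obtain ⟨i, rfl⟩ := Nat.exists_eq_add_of_le hrk
        obtain ⟨j, rfl⟩ := Nat.exists_eq_add_of_le hsl
        obtain ⟨d, hd⟩ : ∃ d, k = p + d := ⟨k - p, by omega⟩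
        rw [Nat.add_sub_cancel_left, Nat.add_sub_cancel_left, show k - p = d by omega,
          triangle_add, triangle_add, ← pow_mul, ← pow_mul, ← zpow_natCast, ← zpow_natCast,
          ← zpow_add₀ hq0, ← zpow_add₀ hq0]
        congr 1
        have hdz : (k : ℤ) = p + d := by omega
        push_cast
        rw [hdz]
        ring
      have hQ : (q ^ 2) ^ (triangle k' + (k * l' + triangle l')) ≠ 0 :=
        pow_ne_zero _ (pow_ne_zero _ hq0)
      rw [hexp]
      field_simp
    · rw [if_neg hrs]
      rcases not_and_or.mp hrs with h | h
      · rw [qBinom_of_neg q _ (show (k' : ℤ) - r < 0 by omega)]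
        simp
      · rw [qBinom_of_neg q _ (show (l' : ℤ) - s < 0 by omega)]
        simp
  · rw [if_neg hcons]
    refine Finset.sum_eq_zero fun r _ => Finset.sum_eq_zero fun s _ => ?_
    have h : ¬ (r : ℤ) + s = (lt : ℤ) - k' + r + ((kt : ℤ) - l' + s) := by omega
    rw [jTrans, if_neg h]
    simp

/-- The matrix entries of the fused `R`-element. The symmetrisers around the rows of `R`-elements
may be inserted, as they fix the two vectors, and then the rows reduce to crossings. -/
theorem rowVec_dotProduct_rRows {q z : ℂ} (hq0 : q ≠ 0) {k l : ℕ}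
    (hq : ∀ n : ℕ, 1 ≤ n → n ≤ l → q ^ (2 * n) ≠ 1) (hk : 1 ≤ k) (hkl : k ≤ l)
    (hz : ∀ a j : ℕ, 1 ≤ a → a ≤ k → 1 ≤ j → j ≤ l → z * q ^ (-2 * ((j : ℤ) - a)) ≠ q ^ 2)
    (x : Fin (k + 1) × Fin (l + 1)) (y : Fin (l + 1) × Fin (k + 1)) :
    rowVec q k l (k + l) x ⬝ᵥ (rRows (q ^ 2) (sigmaFamily q (k + l)) l 0 k z).mulVec
        (colVec q l k (k + l) y) = entryFormula q k l z x.1 x.2 y.1 y.2 := by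
  have hl : 1 ≤ l := hk.trans hkl
  have hz' : ∀ a < k, ∀ j < l, q ^ 2 - z * (q ^ 2) ^ a * (q ^ 2)⁻¹ ^ j ≠ 0 := by
    intro a ha j hj e
    apply hz (a + 1) (j + 1) (by omega) (by omega) (by omega) (by omega)
    have : q ^ (-2 * (((j + 1 : ℕ) : ℤ) - ((a + 1 : ℕ) : ℤ))) = (q ^ 2) ^ a * (q ^ 2)⁻¹ ^ j := by
      rw [inv_pow, ← pow_mul, ← pow_mul, ← zpow_natCast, ← zpow_natCast, ← zpow_neg,
        ← zpow_add₀ hq0]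
      congr 1; push_cast; ring
    rw [this, ← mul_assoc, ← sub_eq_zero.mp e]
  have key := (isHeckeFamily_sigmaFamily q (k + l)).mul_rRows_mul hq0
    (ψ := projMatrix q (k + l) k l) (f := projMatrix q (k + l) l k) (o := 0) (k := k) (l := l)
    (z := z) hq hkl (by omega) hz'
    (fun i _ h1 h2 => projMatrix_mul_sigmaFamily hq0 hq rfl hk hl hkl le_rfl (by omega) (by omega))
    (fun i _ h1 h2 => sigmaFamily_mul_projMatrix hq0 hq (add_comm k l) hl hk le_rfl hkl (by omega)
      (by omega))
  have hfix : ∀ M : Matrix (TWord (k + l)) (TWord (k + l)) ℂ,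
      rowVec q k l (k + l) x ⬝ᵥ M.mulVec (colVec q l k (k + l) y) =
      (projMatrix q (k + l) k l * M * projMatrix q (k + l) l k).mulVec
        (colVec q l k (k + l) y) (blockWord (k + l) k x.1 x.2) := by
    intro M
    have e : (projMatrix q (k + l) l k).mulVec (colVec q l k (k + l) y) =
        colVec q l k (k + l) y := by
      rw [projMatrix_mulVec hq0 hq (add_comm k l) hl hk le_rfl hkl]
      simp [rowVec_dotProduct_colVec hq0 hq (add_comm k l) hl hk le_rfl hkl]
    rw [← Matrix.mulVec_mulVec, e, ← Matrix.mulVec_mulVec, rowVec_eq]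
    rfl
  rw [hfix, key, Matrix.sum_mulVec, Finset.sum_apply]
  simp only [Matrix.smul_mulVec, Pi.smul_apply, ← hfix, smul_eq_mul, zero_add]
  rw [entryFormula]
  split_ifs with hcons
  · refine Finset.sum_congr rfl fun p hp => ?_
    have hp' := Finset.mem_range.mp hp
    rw [rowVec_dotProduct_crossing hq0 hq hk hkl (by omega), if_pos hcons, Finset.mul_sum]
    refine Finset.sum_congr rfl fun r _ => ?_
    rw [Finset.mul_sum]
    refine Finset.sum_congr rfl fun s _ => ?_
    ring
  · refine Finset.sum_eq_zero fun p hp => ?_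
    have hp' := Finset.mem_range.mp hp
    rw [rowVec_dotProduct_crossing hq0 hq hk hkl (by omega), if_neg hcons, mul_zero]

theorem mainTheorem2 (q z : ℂ) (k l : ℕ) (hk : 1 ≤ k) (hkl : k ≤ l)
    (hq0 : q ≠ 0) (hq : ∀ n : ℕ, 1 ≤ n → n ≤ l → q ^ (2 * n) ≠ 1)
    (hz : ∀ a j : ℕ, 1 ≤ a → a ≤ k → 1 ≤ j → j ≤ l → z * q ^ (-2 * ((j : ℤ) - a)) ≠ q ^ 2) :
    (IsBasisOf (colVec q k l (k + l)) (LinearMap.range (projMatrix q (k + l) k l).mulVecLin) ∧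
      IsBasisOf (colVec q l k (k + l)) (LinearMap.range (projMatrix q (k + l) l k).mulVecLin) ∧
      ∀ y : Fin (l + 1) × Fin (k + 1),
        (fusedRMatrix q k l z).mulVec (colVec q l k (k + l) y) =
          ∑ x : Fin (k + 1) × Fin (l + 1),
            entryFormula q k l z x.1 x.2 y.1 y.2 • colVec q k l (k + l) x) ∧
    (IsBasisOf (rowVec q k l (k + l)) (LinearMap.range (projMatrix q (k + l) k l).vecMulLinear) ∧
      IsBasisOf (rowVec q l k (k + l)) (LinearMap.range (projMatrix q (k + l) l k).vecMulLinear) ∧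
      ∀ x : Fin (k + 1) × Fin (l + 1),
        Matrix.vecMul (rowVec q k l (k + l) x) (fusedRMatrix q k l z) =
          ∑ y : Fin (l + 1) × Fin (k + 1),
            entryFormula q k l z x.1 x.2 y.1 y.2 • rowVec q l k (k + l) y) := by
  have hl : 1 ≤ l := hk.trans hkl
  have hlk : k + l = l + k := add_comm k l
  refine ⟨⟨isBasisOf_colVec hq0 hq rfl hk hl hkl le_rfl,
    isBasisOf_colVec hq0 hq hlk hl hk le_rfl hkl, fun y => ?_⟩,
    isBasisOf_rowVec hq0 hq rfl hk hl hkl le_rfl,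
    isBasisOf_rowVec hq0 hq hlk hl hk le_rfl hkl, fun x => ?_⟩
  · have e : (projMatrix q (k + l) l k).mulVec (colVec q l k (k + l) y) =
        colVec q l k (k + l) y := by
      rw [projMatrix_mulVec hq0 hq hlk hl hk le_rfl hkl]
      simp [rowVec_dotProduct_colVec hq0 hq hlk hl hk le_rfl hkl]
    rw [fusedRMatrix_eq q hq0, ← Matrix.mulVec_mulVec, e, ← Matrix.mulVec_mulVec,
      projMatrix_mulVec hq0 hq rfl hk hl hkl le_rfl]
    exact Finset.sum_congr rfl fun x _ => by
      rw [rowVec_dotProduct_rRows hq0 hq hk hkl hz]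
  · have e : Matrix.vecMul (rowVec q k l (k + l) x) (projMatrix q (k + l) k l) =
        rowVec q k l (k + l) x := by
      rw [vecMul_projMatrix hq0 hq rfl hk hl hkl le_rfl]
      simp [rowVec_dotProduct_colVec hq0 hq rfl hk hl hkl le_rfl]
    rw [fusedRMatrix_eq q hq0, ← Matrix.vecMul_vecMul, ← Matrix.vecMul_vecMul, e,
      vecMul_projMatrix hq0 hq hlk hl hk le_rfl hkl]
    exact Finset.sum_congr rfl fun y _ => by
      rw [← Matrix.dotProduct_mulVec, rowVec_dotProduct_rRows hq0 hq hk hkl hz]
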